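/- **Setting.** A signature consists of relation symbols $R$ with arities. A structure $\mathcal A$ assigns to each symbol $R$ a finite relation $R^{\mathcal A}\subseteq\mathbb N^{\mathrm{ar}(R)}$. Let $Q(v_0,\dots,v_{k-1})$ be a full conjunctive query, i.e. a conjunction of finitely many atoms without quantifiers or constants, such that every variable occurs in some atom, every atom has at least one argument, the argument list of each atom is a subsequence of the variable ordering $[v_0,\dots,v_{k-1}]$ without repetitions, and no relation symbol occurs twice. $Q^{\mathcal A}\subseteq\mathbb N^k$ is the set of satisfying assignments. *Renumbering.* View a relation $R\subseteq\mathbb N^r$ as a trie whose root-to-leaf paths are the tuples. Renumbering $R$ at depth $d\in\{0,\dots,r-1\}$ replaces each tuple $(t_0,\dots,t_{r-1})\in R$ by $(t_0,\dots,t_{d-1},\rho,0,\dots,0)$, where $\rho$ is the number of $x<t_d$ such that $(t_0,\dots,t_{d-1},x)$ is a prefix of a tuple of $R$ (duplicates are removed). A structure $\mathcal A'$ is a renumbering of $\mathcal A$ if it arises by renumbering one relation of $\mathcal A$ at one depth. A family of problem instances is a sequence $(\mathbf K_n)_{n\in\mathbb N}$ of classes of structures with $\mathbf K_i\subseteq\mathbf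 K_j$ for $i\le j$; it is closed under renumbering if $\mathcal A\in\mathbf K_n$ implies $\mathcal A'\in\mathbf K_n$ for every renumbering $\mathcal A'$ of $\mathcal A$. *Leapfrog triejoin.* Each atom has one trie iterator on its relation, starting at the root of the trie. $\mathrm{open}()$ moves to the first (least) child key of the current node (to the end if there is none), $\mathrm{up}()$ returns to the parent, $\mathrm{next}()$ moves to the next larger sibling key, $\mathrm{seek}(s)$ to the least sibling key $\ge s$ (to the end if there is none); $\mathrm{key}()$ and $\mathrm{atEnd}()$ report the current key and whether the iterator is at the end. The leapfrog join of $v_i$ uses an array $\mathrm{Iter}[0..\ell-1]$ of the iterators of all atoms that contain $v_i$, and an index $p$: - *init*: if some iterator is at its end, the join is at its end; otherwise sort $\mathrm{Iter}$ by current key, set $p:=0$ and do *search*. - *search*: set $x':=\mathrm{Iter}[(p-1)\bmod \ell].\mathrm{key}()$ and repeat: if $\mathrm{Iter}[p].\mathrm{key}()=x'$, present the key $x'$ and return; otherwise do $\mathrm{Iter}[p].\mathrm{seek}(x')$; if this iterator is now at its end, the join is at its end, return; otherwise set $x':=\mathrm{Iter}[p].\mathrm{key}()$, $p:=(p+1)\bmod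 \ell$. - *next*: do $\mathrm{Iter}[p].\mathrm{next}()$; if this iterator is now at its end, the join is at its end; otherwise set $p:=(p+1)\bmod \ell$ and do *search*. To *open* the variable $v_i$ means to apply $\mathrm{open}()$ to all iterators of its join and then do *init*; to *close* it means to apply $\mathrm{up}()$ to all of them. The algorithm searches for bindings of $v_0,\dots,v_{k-1}$ depth first: it opens $v_0$; when the join of the current variable $v_i$ presents a key, it opens $v_{i+1}$ if $i<k-1$, and outputs the tuple of presented keys and does *next* if $i=k-1$; when the join of $v_i$ is at its end, it closes $v_i$ and does *next* on the join of $v_{i-1}$ if $i>0$, and halts if $i=0$. (If $k=0$ it outputs the empty tuple and halts.) *Time.* On an iterator for a relation with $N$ tuples, each of $\mathrm{open},\mathrm{up},\mathrm{next},\mathrm{seek}$ takes an arbitrary time (possibly dependent on everything that happened before) of at most $\kappa\cdot\max(1,\log_2 N)$. Every other elementary operation takes unit time, and sorting an array of length $\ell$ takes time $\ell^2$. **Theorem.** Let $Q$ be as above and let $\kappa\in\mathbb R$. There is a constant $C$, depending only on $Q$ and $\kappa$, such that the following holds. Let $(\mathbf K_n)_{n\in\mathbb N}$ be a family of problem instances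 closed under renumbering for which, for every $n$, the numbers $$q(n)=\max_{\mathcal A\in\mathbf K_n}|Q^{\mathcal A}|,\qquad M(n)=\max_{\mathcal A\in\mathbf K_n}\max_R|R^{\mathcal A}|$$ exist (the maximum of the empty set is $0$). Then for every $n$ and every $\mathcal A\in\mathbf K_n$, leapfrog triejoin with the variable ordering $[v_0,\dots,v_{k-1}]$, run on $\mathcal A$ with iterators as above, halts and outputs every element of $Q^{\mathcal A}$ exactly once and nothing else. If moreover there is a $\mathcal B\in\mathbf K_n$ with $\emptyset\ne R^{\mathcal B}\supseteq R^{\mathcal A}$ for every relation symbol $R$ of $Q$ (for instance $\mathcal B=\mathcal A$, if no relation of $\mathcal A$ in the query is empty), then its running time is at most $$C\cdot q(n)\cdot\max(1,\log_2 M(n)),$$ i.e. it is $O(q(n)\log M(n))$. -/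

import Mathlib

namespace LFTJ

/-! ## Instances, queries, renumbering -/

/-- A finite relational structure over `ℕ` for the signature with relation symbols `σ` and
arities `ar`: a finite relation for every symbol.  (The universe plays no role for a full
conjunctive query, so it is not recorded.) -/
abbrev Str {σ : Type*} (ar : σ → ℕ) : Type _ := (R : σ) → Finset (Fin (ar R) → ℕ)

/-- A full conjunctive query in the variables `v_0, …, v_{k-1}` (in this variable ordering)
that meets the syntactic restrictions of leapfrog triejoin. -/
structure Query {σ : Type*} (ar : σ → ℕ) (k : ℕ) where
  /-- number of atoms -/
  m : ℕ
  /-- relation symbol of an atom -/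
  rel : Fin m → σ
  /-- no relation symbol is used twice -/
  rel_injective : Function.Injective rel
  /-- argument list of an atom; constants are not allowed -/
  vars : (a : Fin m) → Fin (ar (rel a)) → Fin k
  /-- an argument list is a subsequence of the variable ordering, without repetitions -/
  vars_strictMono : ∀ a, StrictMono (vars a)
  /-- every atom has at least one argument -/
  arity_pos : ∀ a, 0 < ar (rel a)
  /-- every variable occurs in some atom -/
  covers : ∀ v : Fin k, ∃ a j, vars a j = v

section QueryBasics

variable {σ : Type*} {ar : σ → ℕ} {k : ℕ}

/-- The query result: all satisfying assignments of the conjunction. -/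
def Query.result (Q : Query ar k) (A : Str ar) : Set (Fin k → ℕ) :=
  {t | ∀ a : Fin Q.m, (fun j => t (Q.vars a j)) ∈ A (Q.rel a)}

/-- The result is finite, so that `Set.ncard` is its true number of elements. -/
theorem Query.result_finite (Q : Query ar k) (A : Str ar) : (Q.result A).Finite := by
  classical
  have h : Set.InjOn (fun (t : Fin k → ℕ) (a : Fin Q.m) (j : Fin (ar (Q.rel a))) =>
      t (Q.vars a j)) (Q.result A) := by
    intro s _ t _ hst
    funext v
    obtain ⟨a, j, rfl⟩ := Q.covers v
    exact congrFun (congrFun hst a) j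
  refine Set.Finite.of_finite_image (Set.Finite.subset
    (Set.Finite.pi' (fun a : Fin Q.m => (A (Q.rel a)).finite_toSet)) ?_) h
  rintro _ ⟨t, ht, rfl⟩ a
  exact ht a

/-- The atoms that contain the variable `v_i`, i.e. those that take part in the leapfrog join
for `v_i`. -/
def Query.atomsAt (Q : Query ar k) (i : ℕ) : List (Fin Q.m) :=
  (List.finRange Q.m).filter fun a => decide (∃ j, (Q.vars a j : ℕ) = i)

end QueryBasics

/-- In the trie of `R`, the keys of the children of the node at the end of the path
`path 0, …, path (d - 1)`. -/
def children {r : ℕ} (R : Finset (Fin r → ℕ)) (d : Fin r) (path : Fin r → ℕ) : Finset ℕ :=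
  (R.filter fun t => ∀ j, j < d → t j = path j).image fun t => t d

/-- Renumbering of `R` at depth `d`: the children of every node at depth `d - 1` are
renumbered `0, 1, …` in increasing order, all later entries become `0`, and duplicates
disappear. -/
def renumber {r : ℕ} (R : Finset (Fin r → ℕ)) (d : Fin r) : Finset (Fin r → ℕ) :=
  R.image fun t j =>
    if j < d then t j
    else if j = d then ((children R d t).filter fun x => x < t d).card
    else 0

/-- `A'` arises from `A` by renumbering one relation at one depth. -/
def IsRenumbering {σ : Type*} {ar : σ → ℕ} (A A' : Str ar) : Prop :=
  ∃ (R : σ) (d : Fin (ar R)), A' R = renumber (A R) d ∧ ∀ S, S ≠ R → A' S = A S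

/-- A class of structures that is closed under renumbering. -/
def ClosedUnderRenumbering {σ : Type*} {ar : σ → ℕ} (𝒦 : Set (Str ar)) : Prop :=
  ∀ A ∈ 𝒦, ∀ A', IsRenumbering A A' → A' ∈ 𝒦

/-! ## Trie iterators -/

/-- Position of a trie iterator for a relation of arity `r`.  `depth = 0` is the root; at
depth `d + 1` the iterator stands at the key `keys d` among the children of the node
`keys 0, …, keys (d - 1)`, or behind all of them if `atEnd` is set. -/
structure TrieIter (r : ℕ) where
  depth : ℕ
  keys : Fin r → ℕ
  atEnd : Bool

namespace TrieIter

variable {r : ℕ}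

/-- The position at initialization. -/
def root (r : ℕ) : TrieIter r := ⟨0, fun _ => 0, false⟩

/-- Stand at the least key `≥ lb` among the children of the node `keys 0, …, keys (d - 1)`,
or at the end if there is none. -/
def place (R : Finset (Fin r → ℕ)) (keys : Fin r → ℕ) (d : Fin r) (lb : ℕ) : TrieIter r :=
  if h : ((children R d keys).filter fun x => lb ≤ x).Nonempty then
    ⟨d + 1, Function.update keys d (((children R d keys).filter fun x => lb ≤ x).min' h), false⟩
  else ⟨d + 1, keys, true⟩

/-- `key()` -/
def key (it : TrieIter r) : ℕ :=
  match it.depth with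
  | 0 => 0
  | d + 1 => if h : d < r then it.keys ⟨d, h⟩ else 0

/-- `open()`: proceed to the first key at the next depth. -/
def down (R : Finset (Fin r → ℕ)) (it : TrieIter r) : TrieIter r :=
  if h : it.depth < r then place R it.keys ⟨it.depth, h⟩ 0 else it

/-- `up()`: return to the parent key at the previous depth. -/
def up (it : TrieIter r) : TrieIter r := ⟨it.depth - 1, it.keys, false⟩

/-- `seek(seekKey)`: proceed to the least key `≥ seekKey` among the siblings. -/
def seek (R : Finset (Fin r → ℕ)) (seekKey : ℕ) (it : TrieIter r) : TrieIter r :=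
  match it.depth with
  | 0 => it
  | d + 1 => if h : d < r then place R it.keys ⟨d, h⟩ seekKey else it

/-- `next()`: proceed to the next key among the siblings. -/
def next (R : Finset (Fin r → ℕ)) (it : TrieIter r) : TrieIter r :=
  it.seek R (it.key + 1)

end TrieIter

/-- The iterator methods whose running time is only required to be logarithmic. -/
inductive IterOp
  | down | up | next | seek

/-! ## The algorithm, as a machine with a clock -/

/-- State of the leapfrog join of one variable. -/
structure Join (m : ℕ) where
  /-- the array `Iter` of pointers to trie iterators, one for each atom with this variable -/
  iters : List (Fin m)
  /-- the index `p` into this array -/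
  p : ℕ
  /-- the variable `x'` of leapfrog-search -/
  maxKey : ℕ
  /-- the key presented by the join -/
  key : ℕ
  /-- the join is at its end -/
  atEnd : Bool

/-- Program positions. `visit`, `test`, `advance` are the depth-first walk through the trie
presented by the triejoin; `descend` and `ascend` are triejoin-open and triejoin-up; `init`,
`search` (the line before the loop), `loop` (the loop of leapfrog-search) and `advance` are the
methods of the leapfrog join of the current variable. -/
inductive PC
  | visit | descend | init | search | loop | test | ascend | advance | halt

/-- A configuration of leapfrog triejoin. -/
structure Config {σ : Type*} {ar : σ → ℕ} {k : ℕ} (Q : Query ar k) where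
  pc : PC
  /-- number of opened variables; the current variable is `v_{level - 1}` -/
  level : ℕ
  /-- the trie iterators, one for each atom, shared by the leapfrog joins -/
  iter : (a : Fin Q.m) → TrieIter (ar (Q.rel a))
  /-- the leapfrog joins; entry `i` belongs to the variable `v_i` -/
  join : ℕ → Join Q.m
  /-- the tuples produced so far, latest first -/
  out : List (Fin k → ℕ)
  /-- time elapsed -/
  time : ℕ

section Machine

variable {σ : Type*} {ar : σ → ℕ} {k : ℕ} {Q : Query ar k}

/-- The initial configuration. -/
def start (Q : Query ar k) : Config Q where
  pc := .visit
  level := 0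
  iter := fun a => TrieIter.root (ar (Q.rel a))
  join := fun i => ⟨Q.atomsAt i, 0, 0, 0, false⟩
  out := []
  time := 0

/-- Running times of the trie iterator methods: `τ c a op` is the time that the method `op` of
the iterator for atom `a` takes when it is called in configuration `c`.  (As `c` includes the
clock, the time may depend on everything that happened before.) -/
abbrev IterTime (Q : Query ar k) : Type _ := Config Q → Fin Q.m → IterOp → ℕ

/-- The requirement on trie iterators: every method takes time `O(log N)` with the constant `κ`,
where `N` is the cardinality of the relation (and time `O(1)` if `N ≤ 2`). -/
def IterTime.Meets (τ : IterTime Q) (κ : ℝ) (A : Str ar) : Prop :=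
  ∀ c a op, (τ c a op : ℝ) ≤ κ * max 1 (Real.logb 2 (A (Q.rel a)).card)

/-- Execution of the program position of `c`.  Every elementary operation, including the
iterator methods `key()` and `atEnd()`, takes one unit of time; the iterator methods `open()`,
`up()`, `next()` and `seek()` take the time given by `τ`; sorting an array of length `n` takes
`n ^ 2`. -/
def step (A : Str ar) (τ : IterTime Q) (c : Config Q) : Config Q :=
  -- index of the current variable, and its leapfrog join
  let i := c.level - 1
  let J := c.join i
  let n := J.iters.length
  match c.pc with
  | .visit =>
      -- all variables are bound: produce the binding; otherwise go one level deeper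
      if c.level = k then
        { c with
          out := (fun v => (c.join v).key) :: c.out
          pc := .advance
          time := c.time + (k + 2) }
      else { c with pc := .descend, time := c.time + 1 }
  | .descend =>
      { c with
        level := c.level + 1
        iter := fun a =>
          if a ∈ Q.atomsAt c.level then (c.iter a).down (A (Q.rel a)) else c.iter a
        pc := .init
        time := c.time + 1 + ((Q.atomsAt c.level).map fun a => 1 + τ c a .down).sum }
  | .init =>
      if J.iters.any fun a => (c.iter a).atEnd then
        { c with
          join := Function.update c.join i { J with atEnd := true }
          pc := .test
          time := c.time + (n + 2) }
      else
        { c with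
          join := Function.update c.join i
            { J with
              iters := J.iters.insertionSort fun a b => (c.iter a).key ≤ (c.iter b).key
              p := 0
              atEnd := false }
          pc := .search
          time := c.time + (n + 3 + n ^ 2) }
  | .search =>
      match J.iters[(J.p + n - 1) % n]? with
      | none => { c with pc := .halt }
      | some b =>
          { c with
            join := Function.update c.join i { J with maxKey := (c.iter b).key }
            pc := .loop
            time := c.time + 3 }
  | .loop =>
      match J.iters[J.p]? with
      | none => { c with pc := .halt }
      | some a =>
          if (c.iter a).key = J.maxKey then
            { c with
              join := Function.update c.join i { J with key := J.maxKey }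
              pc := .test
              time := c.time + 4 }
          else
            let it := (c.iter a).seek (A (Q.rel a)) J.maxKey
            if it.atEnd then
              { c with
                iter := Function.update c.iter a it
                join := Function.update c.join i { J with atEnd := true }
                pc := .test
                time := c.time + 5 + τ c a .seek }
            else
              { c with
                iter := Function.update c.iter a it
                join := Function.update c.join i
                  { J with maxKey := it.key, p := (J.p + 1) % n }
                pc := .loop
                time := c.time + 7 + τ c a .seek }
  | .test =>
      if J.atEnd then { c with pc := .ascend, time := c.time + 1 }
      else { c with pc := .visit, time := c.time + 1 }
  | .ascend =>
      { c with
        level := c.level - 1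
        iter := fun a => if a ∈ Q.atomsAt i then (c.iter a).up else c.iter a
        pc := .advance
        time := c.time + 1 + ((Q.atomsAt i).map fun a => 1 + τ c a .up).sum }
  | .advance =>
      -- at the root the walk is complete; otherwise leapfrog-next
      if c.level = 0 then { c with pc := .halt, time := c.time + 1 }
      else
        match J.iters[J.p]? with
        | none => { c with pc := .halt }
        | some a =>
            let it := (c.iter a).next (A (Q.rel a))
            if it.atEnd then
              { c with
                iter := Function.update c.iter a it
                join := Function.update c.join i { J with atEnd := true }
                pc := .test
                time := c.time + 4 + τ c a .next }
            else
              { c with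
                iter := Function.update c.iter a it
                join := Function.update c.join i { J with p := (J.p + 1) % n }
                pc := .search
                time := c.time + 4 + τ c a .next }
  | .halt => c

/-- On input `A`, leapfrog triejoin halts in the configuration `c`. -/
def HaltsAt (A : Str ar) (τ : IterTime Q) (c : Config Q) : Prop :=
  c.pc = .halt ∧ ∃ N : ℕ, c = (step A τ)^[N] (start Q)

end Machine

end LFTJ

/-!
Fix values for `v_0, …, v_{i-1}` and consider the leapfrog join of `v_i` below the resulting trie
nodes. Every round through its array of iterators moves each of them forward, so the join makes
at most `O(f)` moves, where `f` is the least number of children among these nodes.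

To compare `f` with the size of a query result, renumber every relation that contains one of the
variables `v_i, v_{i+1}, …` at the depth at which its iterator then stands. This makes the
children of each node an initial segment of `ℕ` and all later entries `0`, so each `x < f` yields
a result `(v_0, …, v_{i-1}, x, 0, …, 0)` of the renumbered structure. Different values of
`v_0, …, v_{i-1}` yield different results, hence the sum of `f` over all prefixes of length `i` that
the algorithm visits is at most `q(n)`. What is renumbered is not `A` but a superset
`B` of it with nonempty relations, because an empty relation would leave no results to count. In
total there are `O(q(n))` steps, each of which takes time `O(log M(n))`.
-/

namespace LFTJ

/-! ## Prefixes of query results -/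

section Prefixes

variable {σ : Type*} {ar : σ → ℕ} {k : ℕ} (Q : Query ar k)

/-- The number of arguments of the atom `a` among the variables before `v_i`, i.e. the depth
that the trie iterator of `a` has when these variables are bound. -/
def Query.depthAt (a : Fin Q.m) (i : ℕ) : ℕ :=
  ({j | (Q.vars a j : ℕ) < i} : Finset (Fin (ar (Q.rel a)))).card

variable {Q}

theorem Query.lt_depthAt_iff {a : Fin Q.m} {i : ℕ} {j : Fin (ar (Q.rel a))} :
    (j : ℕ) < Q.depthAt a i ↔ (Q.vars a j : ℕ) < i :=
  Tuple.lt_card_lt_iff_apply_lt_of_monotone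
    (Fin.val_strictMono.monotone.comp (Q.vars_strictMono a).monotone)

theorem Query.depthAt_zero (a : Fin Q.m) : Q.depthAt a 0 = 0 := by
  simp [Query.depthAt]

theorem Query.depthAt_eq_of_vars_eq {a : Fin Q.m} {i : ℕ} {j : Fin (ar (Q.rel a))}
    (h : (Q.vars a j : ℕ) = i) : Q.depthAt a i = j := by
  have hIio : ({j' | (Q.vars a j' : ℕ) < i} : Finset _) = Finset.Iio j := by
    ext j'
    simp [← h, (Q.vars_strictMono a).lt_iff_lt]
  rw [Query.depthAt, hIio, Fin.card_Iio]

theorem Query.depthAt_succ_of_vars_eq {a : Fin Q.m} {i : ℕ} {j : Fin (ar (Q.rel a))}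
    (h : (Q.vars a j : ℕ) = i) : Q.depthAt a (i + 1) = j + 1 := by
  have hIic : ({j' | (Q.vars a j' : ℕ) < i + 1} : Finset _) = Finset.Iic j := by
    ext j'
    simp [← h, (Q.vars_strictMono a).le_iff_le]
  rw [Query.depthAt, hIic, Fin.card_Iic]

theorem Query.mem_atomsAt {a : Fin Q.m} {i : ℕ} :
    a ∈ Q.atomsAt i ↔ ∃ j, (Q.vars a j : ℕ) = i := by
  simp [Query.atomsAt]

theorem Query.nodup_atomsAt (i : ℕ) : (Q.atomsAt i).Nodup :=
  (List.nodup_finRange _).filter _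

theorem Query.length_atomsAt_le (i : ℕ) : (Q.atomsAt i).length ≤ Q.m :=
  (List.length_filter_le _ _).trans_eq List.length_finRange

theorem Query.exists_mem_atomsAt {i : ℕ} (hi : i < k) : ∃ a, a ∈ Q.atomsAt i := by
  obtain ⟨a, j, h⟩ := Q.covers ⟨i, hi⟩
  exact ⟨a, Query.mem_atomsAt.2 ⟨j, by rw [h]⟩⟩

theorem Query.depthAt_lt_of_mem {a : Fin Q.m} {i : ℕ} (h : a ∈ Q.atomsAt i) :
    Q.depthAt a i < ar (Q.rel a) := by
  obtain ⟨j, hj⟩ := Query.mem_atomsAt.1 h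
  exact Query.depthAt_eq_of_vars_eq hj ▸ j.2

theorem Query.depthAt_succ_of_mem {a : Fin Q.m} {i : ℕ} (h : a ∈ Q.atomsAt i) :
    Q.depthAt a (i + 1) = Q.depthAt a i + 1 := by
  obtain ⟨j, hj⟩ := Query.mem_atomsAt.1 h
  rw [Query.depthAt_succ_of_vars_eq hj, Query.depthAt_eq_of_vars_eq hj]

theorem Query.vars_lt_succ_iff_of_notMem {a : Fin Q.m} {i : ℕ} (h : a ∉ Q.atomsAt i)
    (j : Fin (ar (Q.rel a))) : (Q.vars a j : ℕ) < i + 1 ↔ (Q.vars a j : ℕ) < i := by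
  have : (Q.vars a j : ℕ) ≠ i := fun e => h (Query.mem_atomsAt.2 ⟨j, e⟩)
  omega

theorem Query.depthAt_succ_of_notMem {a : Fin Q.m} {i : ℕ} (h : a ∉ Q.atomsAt i) :
    Q.depthAt a (i + 1) = Q.depthAt a i := by
  simp only [Query.depthAt, Query.vars_lt_succ_iff_of_notMem h]

theorem children_congr {r : ℕ} {R : Finset (Fin r → ℕ)} {d : Fin r} {s t : Fin r → ℕ}
    (h : ∀ j < d, s j = t j) : children R d s = children R d t := by
  unfold children
  congr 1
  exact Finset.filter_congr fun u _ => forall₂_congr fun j hj => by rw [h j hj]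

theorem mem_children {r : ℕ} {R : Finset (Fin r → ℕ)} {d : Fin r} {s : Fin r → ℕ} {x : ℕ} :
    x ∈ children R d s ↔ ∃ u ∈ R, (∀ j < d, u j = s j) ∧ u d = x := by
  simp [children, and_assoc]

variable (Q) in
/-- The keys of the children of the trie node that the atom `a` reaches with the values that
`t` gives to the variables before `v_i`. Assignments to an initial segment of the variables are
encoded as functions `ℕ → ℕ` of which only this segment matters. -/
def Query.childKeys (A : Str ar) (t : ℕ → ℕ) (a : Fin Q.m) (i : ℕ) : Finset ℕ :=
  if h : Q.depthAt a i < ar (Q.rel a) then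
    children (A (Q.rel a)) ⟨Q.depthAt a i, h⟩ fun j => t (Q.vars a j)
  else ∅

theorem Query.children_eq_childKeys {A : Str ar} {t : ℕ → ℕ} {a : Fin Q.m} {i : ℕ}
    {d : Fin (ar (Q.rel a))} (hd : Q.depthAt a i = d) {s : Fin (ar (Q.rel a)) → ℕ}
    (hs : ∀ j, (Q.vars a j : ℕ) < i → s j = t (Q.vars a j)) :
    children (A (Q.rel a)) d s = Q.childKeys A t a i := by
  simp only [Query.childKeys, hd, d.2, dif_pos]
  exact children_congr fun j hj => hs j (Query.lt_depthAt_iff.1 (hd ▸ hj))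

theorem Query.mem_childKeys {A : Str ar} {t : ℕ → ℕ} {a : Fin Q.m} {i x : ℕ} :
    x ∈ Q.childKeys A t a i ↔ ∃ u ∈ A (Q.rel a), ∃ d : Fin (ar (Q.rel a)), Q.depthAt a i = d ∧
      (∀ j, (Q.vars a j : ℕ) < i → u j = t (Q.vars a j)) ∧ u d = x := by
  simp only [← Query.lt_depthAt_iff]
  constructor
  · unfold Query.childKeys
    split_ifs with h
    · intro hx
      obtain ⟨u, hu, hut, hux⟩ := mem_children.1 hx
      exact ⟨u, hu, _, rfl, fun j => hut j, hux⟩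
    · simp
  · rintro ⟨u, hu, d, hd, hut, hux⟩
    rw [← Query.children_eq_childKeys hd fun _ _ => rfl, mem_children]
    exact ⟨u, hu, fun j hj => hut j (hd ▸ hj), hux⟩

theorem Query.childKeys_mono {A B : Str ar} (h : ∀ a, A (Q.rel a) ⊆ B (Q.rel a)) (t : ℕ → ℕ)
    (a : Fin Q.m) (i : ℕ) : Q.childKeys A t a i ⊆ Q.childKeys B t a i := by
  intro x hx
  obtain ⟨u, hu, hux⟩ := Query.mem_childKeys.1 hx
  exact Query.mem_childKeys.2 ⟨u, h a hu, hux⟩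

variable (Q) in
/-- The keys that the leapfrog join of `v_i` presents when the variables before `v_i` have the
values given by `t`. -/
def Query.commonKeys (A : Str ar) (t : ℕ → ℕ) (i : ℕ) : Finset ℕ :=
  (Finset.univ.biUnion fun a => Q.childKeys A t a i).filter fun x =>
    ∀ a ∈ Q.atomsAt i, x ∈ Q.childKeys A t a i

theorem Query.mem_commonKeys {A : Str ar} {t : ℕ → ℕ} {i x : ℕ} (hi : i < k) :
    x ∈ Q.commonKeys A t i ↔ ∀ a ∈ Q.atomsAt i, x ∈ Q.childKeys A t a i := by
  obtain ⟨a, ha⟩ := Query.exists_mem_atomsAt (Q := Q) hi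
  simp only [Query.commonKeys, Finset.mem_filter, Finset.mem_biUnion, Finset.mem_univ, true_and,
    and_iff_right_iff_imp]
  exact fun h => ⟨a, h a ha⟩

variable (Q) in
/-- The least number of children of the trie nodes that take part in the leapfrog join of `v_i`
when the variables before `v_i` have the values given by `t` (and `0` if there is no such node,
i.e. for `k ≤ i`). -/
noncomputable def Query.fanout (A : Str ar) (t : ℕ → ℕ) (i : ℕ) : ℕ :=
  ⨅ a : {a // a ∈ Q.atomsAt i}, (Q.childKeys A t a i).card

theorem Query.fanout_le {a : Fin Q.m} {i : ℕ} (ha : a ∈ Q.atomsAt i) (A : Str ar) (t : ℕ → ℕ) :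
    Q.fanout A t i ≤ (Q.childKeys A t a i).card :=
  ciInf_le (OrderBot.bddBelow _) (⟨a, ha⟩ : {a // a ∈ Q.atomsAt i})

theorem Query.exists_card_childKeys_eq_fanout {i : ℕ} (hi : i < k) (A : Str ar) (t : ℕ → ℕ) :
    ∃ a ∈ Q.atomsAt i, (Q.childKeys A t a i).card = Q.fanout A t i := by
  have : Nonempty {a // a ∈ Q.atomsAt i} := nonempty_subtype.2 (Query.exists_mem_atomsAt hi)
  obtain ⟨⟨a, ha⟩, h⟩ := ciInf_mem fun a : {a // a ∈ Q.atomsAt i} => (Q.childKeys A t a i).card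
  exact ⟨a, ha, h⟩

theorem Query.card_commonKeys_le_fanout {i : ℕ} (hi : i < k) (A : Str ar) (t : ℕ → ℕ) :
    (Q.commonKeys A t i).card ≤ Q.fanout A t i := by
  obtain ⟨a, ha, hcard⟩ := Query.exists_card_childKeys_eq_fanout hi A t
  rw [← hcard]
  exact Finset.card_le_card fun x hx => (Query.mem_commonKeys hi).1 hx a ha

theorem Query.fanout_mono {A B : Str ar} (h : ∀ a, A (Q.rel a) ⊆ B (Q.rel a)) {i : ℕ}
    (hi : i < k) (t : ℕ → ℕ) : Q.fanout A t i ≤ Q.fanout B t i := by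
  obtain ⟨a, ha, hcard⟩ := Query.exists_card_childKeys_eq_fanout hi B t
  exact hcard ▸ (Query.fanout_le ha A t).trans (Finset.card_le_card (Query.childKeys_mono h t a i))

variable (Q) in
/-- The values that `t` gives to the variables before `v_i` form a prefix of a tuple of each
atom that contains one of these variables. -/
def Query.Consistent (A : Str ar) (t : ℕ → ℕ) (i : ℕ) : Prop :=
  ∀ a, (∃ j, (Q.vars a j : ℕ) < i) →
    ∃ u ∈ A (Q.rel a), ∀ j, (Q.vars a j : ℕ) < i → u j = t (Q.vars a j)

theorem Query.consistent_zero (A : Str ar) (t : ℕ → ℕ) : Q.Consistent A t 0 :=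
  fun _ ⟨_, h⟩ => absurd h (Nat.not_lt_zero _)

theorem Query.Consistent.update {A : Str ar} {i : ℕ} {t : ℕ → ℕ} (h : Q.Consistent A t i)
    {x : ℕ} (hx : ∀ a ∈ Q.atomsAt i, x ∈ Q.childKeys A t a i) :
    Q.Consistent A (Function.update t i x) (i + 1) := by
  intro a ha
  by_cases hm : a ∈ Q.atomsAt i
  · obtain ⟨u, hu, d, hd, hut, hux⟩ := Query.mem_childKeys.1 (hx a hm)
    refine ⟨u, hu, fun j hj => ?_⟩
    rcases Nat.lt_succ_iff_lt_or_eq.1 hj with hj | hj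
    · rw [Function.update_of_ne hj.ne, hut j hj]
    · obtain rfl : j = d := Fin.ext ((Query.depthAt_eq_of_vars_eq hj).symm.trans hd)
      rw [hj, Function.update_self, hux]
  · simp only [Query.vars_lt_succ_iff_of_notMem hm] at ha ⊢
    obtain ⟨u, hu, hut⟩ := h a ha
    exact ⟨u, hu, fun j hj => by rw [Function.update_of_ne hj.ne, hut j hj]⟩

theorem Query.Consistent.mem_result {A : Str ar} {t : ℕ → ℕ} (h : Q.Consistent A t k) :
    (fun v : Fin k => t v) ∈ Q.result A := by
  intro a
  obtain ⟨u, hu, hut⟩ := h a ⟨⟨0, Q.arity_pos a⟩, Fin.is_lt _⟩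
  obtain rfl : u = fun j => t (Q.vars a j) := funext fun j => hut j (Fin.is_lt _)
  exact hu

theorem Query.mem_childKeys_of_mem_result {A : Str ar} {v : Fin k} {t : ℕ → ℕ}
    {s : Fin k → ℕ} (hs : s ∈ Q.result A) (hst : ∀ w < v, s w = t w)
    {a : Fin Q.m} (ha : a ∈ Q.atomsAt v) : s v ∈ Q.childKeys A t a v := by
  obtain ⟨d, hd⟩ := Query.mem_atomsAt.1 ha
  exact Query.mem_childKeys.2 ⟨_, hs a, d, Query.depthAt_eq_of_vars_eq hd,
    fun j hj => hst _ hj, congrArg s (Fin.ext hd)⟩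

end Prefixes

section Extensions

variable {σ : Type*} {ar : σ → ℕ} {k : ℕ} (Q : Query ar k)

/-- The results of the query that agree with `t` on the variables before `v_i`. -/
noncomputable def Query.extensions (A : Str ar) (t : ℕ → ℕ) (i : ℕ) : Finset (Fin k → ℕ) :=
  (Q.result_finite A).toFinset.filter fun s => ∀ v : Fin k, (v : ℕ) < i → s v = t v

/-- The results of the query that agree with `t` on the variables before `v_i` and give `v_i` a
value of at least `lb`: what remains to be produced once the keys below `lb` are done. -/
noncomputable def Query.extensionsFrom (A : Str ar) (t : ℕ → ℕ) (i lb : ℕ) :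
    Finset (Fin k → ℕ) :=
  (Q.extensions A t i).filter fun s => ∀ v : Fin k, (v : ℕ) = i → lb ≤ s v

variable {Q} {A : Str ar} {t : ℕ → ℕ} {i lb x : ℕ} {a : Fin Q.m}

theorem Query.mem_extensions {s : Fin k → ℕ} :
    s ∈ Q.extensions A t i ↔ s ∈ Q.result A ∧ ∀ v : Fin k, (v : ℕ) < i → s v = t v := by
  simp [Query.extensions]

theorem Query.mem_extensions_zero {s : Fin k → ℕ} :
    s ∈ Q.extensions A t 0 ↔ s ∈ Q.result A := by
  simp [Query.mem_extensions]

theorem Query.card_extensions_le (A : Str ar) (t : ℕ → ℕ) (i : ℕ) :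
    (Q.extensions A t i).card ≤ (Q.result A).ncard := by
  rw [Set.ncard_eq_toFinset_card _ (Q.result_finite A)]
  exact Finset.card_filter_le _ _

theorem Query.Consistent.extensions_eq_singleton (h : Q.Consistent A t k) :
    Q.extensions A t k = {fun v : Fin k => t v} := by
  ext s
  simp only [Query.mem_extensions, Fin.is_lt, forall_const, Finset.mem_singleton, ← funext_iff]
  exact and_iff_right_of_imp fun hs => hs ▸ h.mem_result

theorem Query.mem_extensions_update (hi : i < k) {s : Fin k → ℕ} :
    s ∈ Q.extensions A (Function.update t i x) (i + 1) ↔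
      s ∈ Q.extensions A t i ∧ s ⟨i, hi⟩ = x := by
  simp only [Query.mem_extensions, and_assoc, and_congr_right_iff]
  refine fun _ => ⟨fun h => ⟨fun v hv => ?_, ?_⟩, fun ⟨h, hx⟩ v hv => ?_⟩
  · rw [h v (by omega), Function.update_of_ne hv.ne]
  · rw [h ⟨i, hi⟩ (Nat.lt_succ_self i), Function.update_self]
  · rcases Nat.lt_succ_iff_lt_or_eq.1 hv with hv | rfl
    · rw [h v hv, Function.update_of_ne hv.ne]
    · rw [Function.update_self, ← hx]

theorem Query.sum_card_extensions_update_le (hi : i < k) (A : Str ar) (t : ℕ → ℕ)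
    (S : Finset ℕ) :
    ∑ x ∈ S, (Q.extensions A (Function.update t i x) (i + 1)).card ≤
      (Q.extensions A t i).card := by
  rw [← Finset.card_biUnion]
  · exact Finset.card_le_card <| Finset.biUnion_subset.2 fun x _ s hs =>
      ((Query.mem_extensions_update hi).1 hs).1
  · exact fun x _ y _ hxy => Finset.disjoint_left.2 fun s hsx hsy => hxy <|
      ((Query.mem_extensions_update hi).1 hsx).2.symm.trans
        ((Query.mem_extensions_update hi).1 hsy).2

theorem Query.mem_extensionsFrom (hi : i < k) {s : Fin k → ℕ} :
    s ∈ Q.extensionsFrom A t i lb ↔ s ∈ Q.extensions A t i ∧ lb ≤ s ⟨i, hi⟩ := by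
  simp only [Query.extensionsFrom, Finset.mem_filter, and_congr_right_iff]
  exact fun _ => ⟨fun h => h _ rfl, fun h v hv => (Fin.ext hv : v = ⟨i, hi⟩) ▸ h⟩

theorem Query.extensionsFrom_zero : Q.extensionsFrom A t i 0 = Q.extensions A t i := by
  simp [Query.extensionsFrom]

theorem Query.mem_childKeys_of_mem_extensions (hi : i < k) (ha : a ∈ Q.atomsAt i)
    {s : Fin k → ℕ} (hs : s ∈ Q.extensions A t i) : s ⟨i, hi⟩ ∈ Q.childKeys A t a i :=
  have hs := Query.mem_extensions.1 hs
  Query.mem_childKeys_of_mem_result (v := ⟨i, hi⟩) hs.1 (fun w hw => hs.2 w hw) ha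

theorem Query.extensionsFrom_eq_empty (hi : i < k) (ha : a ∈ Q.atomsAt i)
    (h : ∀ y ∈ Q.childKeys A t a i, y < lb) : Q.extensionsFrom A t i lb = ∅ := by
  refine Finset.eq_empty_of_forall_notMem fun s hs => ?_
  obtain ⟨hs, hlb⟩ := (Query.mem_extensionsFrom hi).1 hs
  exact hlb.not_gt (h _ (Query.mem_childKeys_of_mem_extensions hi ha hs))

theorem Query.extensionsFrom_eq_of_isLeast (hi : i < k) (ha : a ∈ Q.atomsAt i)
    (h : IsLeast {y | y ∈ Q.childKeys A t a i ∧ lb ≤ y} x) :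
    Q.extensionsFrom A t i lb = Q.extensionsFrom A t i x := by
  ext s
  simp only [Query.mem_extensionsFrom hi, and_congr_right_iff]
  exact fun hs => ⟨fun hlb => h.2 ⟨Query.mem_childKeys_of_mem_extensions hi ha hs, hlb⟩,
    h.1.2.trans⟩

theorem Query.extensionsFrom_eq_union (hi : i < k) (A : Str ar) (t : ℕ → ℕ) (x : ℕ) :
    Q.extensionsFrom A t i x =
      Q.extensions A (Function.update t i x) (i + 1) ∪ Q.extensionsFrom A t i (x + 1) := by
  ext s
  simp only [Query.mem_extensionsFrom hi, Finset.mem_union, Query.mem_extensions_update hi,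
    ← and_or_left, and_congr_right_iff]
  omega

theorem Query.disjoint_extensions_update_extensionsFrom (hi : i < k) (A : Str ar) (t : ℕ → ℕ)
    (x : ℕ) : Disjoint (Q.extensions A (Function.update t i x) (i + 1))
      (Q.extensionsFrom A t i (x + 1)) := by
  refine Finset.disjoint_left.2 fun s hs hs' => ?_
  have hx := ((Query.mem_extensions_update hi).1 hs).2
  have hx' := ((Query.mem_extensionsFrom hi).1 hs').2
  omega

end Extensions

/-! ## Counting with renumbered structures -/

section Renumbering

variable {σ : Type*} {ar : σ → ℕ} {k : ℕ} {Q : Query ar k}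

theorem exists_card_filter_lt_eq {α : Type*} [LinearOrder α] (S : Finset α) {x : ℕ}
    (hx : x < S.card) : ∃ y ∈ S, (S.filter fun z => z < y).card = x := by
  let e := S.orderEmbOfFin rfl
  have hfilter : (S.filter fun z => z < e ⟨x, hx⟩) = (Finset.Iio ⟨x, hx⟩).map e.toEmbedding := by
    ext z
    rw [Finset.mem_filter, ← Finset.mem_coe, ← S.range_orderEmbOfFin rfl]
    constructor
    · rintro ⟨⟨w, rfl⟩, hlt⟩
      exact Finset.mem_map_of_mem _ (Finset.mem_Iio.2 (e.lt_iff_lt.1 hlt))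
    · intro hz
      obtain ⟨w, hw, rfl⟩ := Finset.mem_map.1 hz
      exact ⟨⟨w, rfl⟩, e.lt_iff_lt.2 (Finset.mem_Iio.1 hw)⟩
  exact ⟨e ⟨x, hx⟩, S.orderEmbOfFin_mem rfl _, by rw [hfilter, Finset.card_map, Fin.card_Iio]⟩

theorem mem_renumber_of_lt_card {r : ℕ} {R : Finset (Fin r → ℕ)} {d : Fin r} {s : Fin r → ℕ}
    (hs : s d < (children R d s).card) (h0 : ∀ j, d < j → s j = 0) : s ∈ renumber R d := by
  obtain ⟨y, hy, hcard⟩ := exists_card_filter_lt_eq _ hs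
  obtain ⟨u, hu, hus, rfl⟩ := mem_children.1 hy
  refine Finset.mem_image.2 ⟨u, hu, funext fun j => ?_⟩
  rcases lt_trichotomy j d with h | rfl | h
  · rw [if_pos h, hus j h]
  · rw [if_neg (lt_irrefl _), if_pos rfl, children_congr hus, hcard]
  · rw [if_neg h.not_gt, if_neg h.ne', h0 j h]

/-- As no relation symbol occurs in two atoms, the relations of the atoms can be renumbered
independently of each other. -/
theorem ClosedUnderRenumbering.exists_forall_rel_eq {𝒦 : Set (Str ar)}
    (h𝒦 : ClosedUnderRenumbering 𝒦) {B : Str ar} (hB : B ∈ 𝒦)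
    {f : ∀ a, Finset (Fin (ar (Q.rel a)) → ℕ)}
    (hf : ∀ a, f a = B (Q.rel a) ∨ ∃ d, f a = renumber (B (Q.rel a)) d) :
    ∃ B' ∈ 𝒦, ∀ a, B' (Q.rel a) = f a := by
  classical
  suffices h : ∀ s : Finset (Fin Q.m), ∃ B' ∈ 𝒦, ∀ a,
      B' (Q.rel a) = if a ∈ s then f a else B (Q.rel a) by
    simpa using h Finset.univ
  intro s
  induction s using Finset.induction_on with
  | empty => exact ⟨B, hB, by simp⟩
  | insert b s hb ih =>
    obtain ⟨B', hB', h⟩ := ih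
    refine ⟨Function.update B' (Q.rel b) (f b), ?_, fun a => ?_⟩
    · rcases hf b with hfb | ⟨d, hfb⟩
      · rwa [hfb, ← (h b).trans (if_neg hb), Function.update_eq_self]
      · refine h𝒦 B' hB' _ ⟨Q.rel b, d, ?_, fun S hS => Function.update_of_ne hS _ _⟩
        rw [Function.update_self, hfb, h b, if_neg hb]
    · rcases eq_or_ne a b with rfl | hne
      · simp
      · rw [Function.update_of_ne (Q.rel_injective.ne hne), h a]
        simp [hne]

variable (Q) in
/-- `B'` arises from `B` by renumbering the relation of every atom at the depth that comes
after the variables before `v_i`, where there is such a depth. -/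
def Query.RenumberedAt (i : ℕ) (B B' : Str ar) : Prop :=
  ∀ a, B' (Q.rel a) =
    if h : Q.depthAt a i < ar (Q.rel a) then renumber (B (Q.rel a)) ⟨_, h⟩ else B (Q.rel a)

theorem ClosedUnderRenumbering.exists_renumberedAt {𝒦 : Set (Str ar)}
    (h𝒦 : ClosedUnderRenumbering 𝒦) {B : Str ar} (hB : B ∈ 𝒦) (i : ℕ) :
    ∃ B' ∈ 𝒦, Q.RenumberedAt i B B' := by
  refine h𝒦.exists_forall_rel_eq hB fun a => ?_
  split_ifs with h
  · exact .inr ⟨_, rfl⟩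
  · exact .inl rfl

/-- The assignment that agrees with `t` before `v_i`, is `x` at `v_i` and `0` after `v_i`. -/
def zeroExtend (t : ℕ → ℕ) (i x : ℕ) (j : ℕ) : ℕ :=
  if j < i then t j else if j = i then x else 0

theorem Query.RenumberedAt.zeroExtend_mem_result {i : ℕ} {B B' : Str ar}
    (h : Q.RenumberedAt i B B') (hB : ∀ a, (B (Q.rel a)).Nonempty) {t : ℕ → ℕ}
    (ht : Q.Consistent B t i) {x : ℕ}
    (hx : ∀ a ∈ Q.atomsAt i, x < (Q.childKeys B t a i).card) :
    (fun v : Fin k => zeroExtend t i x v) ∈ Q.result B' := by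
  intro a
  have zeroExtend_of_lt : ∀ j, (Q.vars a j : ℕ) < i →
      zeroExtend t i x (Q.vars a j) = t (Q.vars a j) := fun _ h => if_pos h
  obtain ⟨u, hu, hut⟩ : ∃ u ∈ B (Q.rel a), ∀ j, (Q.vars a j : ℕ) < i → u j = t (Q.vars a j) := by
    by_cases ha : ∃ j, (Q.vars a j : ℕ) < i
    · exact ht a ha
    · obtain ⟨u, hu⟩ := hB a
      exact ⟨u, hu, fun j hj => absurd ⟨j, hj⟩ ha⟩
  rw [h a]
  split_ifs with hd
  · have hvar : i ≤ Q.vars a ⟨Q.depthAt a i, hd⟩ :=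
      not_lt.1 (Query.lt_depthAt_iff.not.1 (lt_irrefl _))
    refine mem_renumber_of_lt_card ?_ fun j hj => ?_
    · rw [Query.children_eq_childKeys rfl zeroExtend_of_lt]
      simp only [zeroExtend, if_neg hvar.not_gt]
      split_ifs with he
      · exact hx a (Query.mem_atomsAt.2 ⟨_, he⟩)
      · exact Finset.card_pos.2 ⟨_, Query.mem_childKeys.2 ⟨u, hu, ⟨_, hd⟩, rfl, hut, rfl⟩⟩
    · have hlt := hvar.trans_lt (Fin.lt_def.1 (Q.vars_strictMono a hj))
      simp only [zeroExtend, if_neg hlt.not_gt, if_neg hlt.ne']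
  · have heq : u = fun j => zeroExtend t i x (Q.vars a j) := funext fun j =>
      have hj := Query.lt_depthAt_iff.1 (j.2.trans_le (not_lt.1 hd))
      (hut j hj).trans (zeroExtend_of_lt j hj).symm
    exact heq ▸ hu

theorem Query.RenumberedAt.fanout_le_card_extensions {i : ℕ} (hi : i < k) {B B' : Str ar}
    (h : Q.RenumberedAt i B B') (hB : ∀ a, (B (Q.rel a)).Nonempty) {t : ℕ → ℕ}
    (ht : Q.Consistent B t i) : Q.fanout B t i ≤ (Q.extensions B' t i).card := by
  rw [← Finset.card_range (Q.fanout B t i)]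
  refine Finset.card_le_card_of_injOn (fun x v => zeroExtend t i x v) (fun x hx => ?_) ?_
  · have hxlt := Finset.mem_range.1 (Finset.mem_coe.1 hx)
    exact Query.mem_extensions.2 ⟨h.zeroExtend_mem_result hB ht fun a ha =>
      hxlt.trans_le (Query.fanout_le ha B t), fun v hv => if_pos hv⟩
  · intro x _ y _ hxy
    simpa [zeroExtend] using congrFun hxy ⟨i, hi⟩

theorem Query.RenumberedAt.ncard_result_pos {B B' : Str ar} (h : Q.RenumberedAt 0 B B')
    (hB : ∀ a, (B (Q.rel a)).Nonempty) : 0 < (Q.result B').ncard := by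
  refine (Set.ncard_pos (Q.result_finite B')).2 ⟨_, h.zeroExtend_mem_result hB
    (Query.consistent_zero B fun _ => 0) (x := 0) fun a ha => ?_⟩
  obtain ⟨u, hu⟩ := hB a
  exact Finset.card_pos.2 ⟨_, Query.mem_childKeys.2 ⟨u, hu, ⟨_, Query.depthAt_lt_of_mem ha⟩, rfl,
    fun j hj => absurd hj (Nat.not_lt_zero _), rfl⟩⟩

end Renumbering

section StepBound

variable {σ : Type*} {ar : σ → ℕ} {k : ℕ} (Q : Query ar k)

/-- A bound for the number of steps between the visit of the node that binds the variables
before `v_i` to the values given by `t` and the return from it, if `n` variables are left. -/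
noncomputable def Query.stepBound (A : Str ar) : ℕ → ℕ → (ℕ → ℕ) → ℕ
  | 0, _, _ => 1
  | n + 1, i, t => 4 * (Q.m * Q.fanout A t i) + 5 +
      ∑ x ∈ Q.commonKeys A t i, Query.stepBound A n (i + 1) (Function.update t i x)

variable {Q}

theorem Query.stepBound_le {A B : Str ar} (hAB : ∀ a, A (Q.rel a) ⊆ B (Q.rel a))
    (hB : ∀ a, (B (Q.rel a)).Nonempty) {B' : ℕ → Str ar} (hB' : ∀ i, Q.RenumberedAt i B (B' i)) :
    ∀ {n i : ℕ} {t : ℕ → ℕ}, i + n = k → Q.Consistent B t i →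
      Q.stepBound A n i t ≤
        5 + ∑ j ∈ Finset.Ico i k, (4 * Q.m + 5) * (Q.extensions (B' j) t i).card
  | 0, _, _, _, _ => (Nat.le_add_left 1 4).trans (Nat.le_add_right _ _)
  | n + 1, i, t, hik, ht => by
    have hi : i < k := by omega
    have hfanout : Q.fanout A t i ≤ (Q.extensions (B' i) t i).card :=
      (Query.fanout_mono hAB hi t).trans ((hB' i).fanout_le_card_extensions hi hB ht)
    have hchildren : ∑ x ∈ Q.commonKeys A t i, Q.stepBound A n (i + 1) (Function.update t i x) ≤
        (Q.commonKeys A t i).card * 5 +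
          ∑ j ∈ Finset.Ico (i + 1) k, (4 * Q.m + 5) * (Q.extensions (B' j) t i).card :=
      calc
        _ ≤ ∑ x ∈ Q.commonKeys A t i, (5 + ∑ j ∈ Finset.Ico (i + 1) k,
              (4 * Q.m + 5) * (Q.extensions (B' j) (Function.update t i x) (i + 1)).card) :=
          Finset.sum_le_sum fun x hx => Query.stepBound_le hAB hB hB' (by omega) <|
            ht.update fun a ha =>
              Query.childKeys_mono hAB t a i ((Query.mem_commonKeys hi).1 hx a ha)
        _ = (Q.commonKeys A t i).card * 5 + ∑ j ∈ Finset.Ico (i + 1) k, (4 * Q.m + 5) *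
              ∑ x ∈ Q.commonKeys A t i,
                (Q.extensions (B' j) (Function.update t i x) (i + 1)).card := by
          simp only [Finset.sum_add_distrib, Finset.sum_const, smul_eq_mul, Finset.mul_sum]
          rw [Finset.sum_comm]
        _ ≤ _ := by
          gcongr
          exact Query.sum_card_extensions_update_le hi _ _ _
    have hcommon := (Query.card_commonKeys_le_fanout hi A t).trans hfanout
    rw [Query.stepBound, Finset.sum_eq_sum_Ico_succ_bot hi]
    linarith [Nat.mul_le_mul_left Q.m hfanout]

theorem Query.stepBound_le_mul {A B : Str ar} {𝒦 : Set (Str ar)}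
    (h𝒦 : ClosedUnderRenumbering 𝒦) {q : ℕ} (hq : ∀ D ∈ 𝒦, (Q.result D).ncard ≤ q)
    (hBK : B ∈ 𝒦) (hB : ∀ a, A (Q.rel a) ⊆ B (Q.rel a) ∧ (B (Q.rel a)).Nonempty) (t : ℕ → ℕ) :
    Q.stepBound A k 0 t + 1 ≤ (6 + k * (4 * Q.m + 5)) * q := by
  choose B' hB'𝒦 hB' using fun i => h𝒦.exists_renumberedAt (Q := Q) hBK i
  have hext : ∀ i, (Q.extensions (B' i) t 0).card ≤ q := fun i =>
    (Query.card_extensions_le _ _ _).trans (hq _ (hB'𝒦 i))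
  have hq_pos : 1 ≤ q := ((hB' 0).ncard_result_pos fun a => (hB a).2).trans_le (hq _ (hB'𝒦 0))
  calc
    Q.stepBound A k 0 t + 1
      ≤ 5 + ∑ i ∈ Finset.Ico 0 k, (4 * Q.m + 5) * (Q.extensions (B' i) t 0).card + 1 := by
        gcongr
        exact Query.stepBound_le (fun a => (hB a).1) (fun a => (hB a).2) hB' (zero_add k)
          (Query.consistent_zero B t)
    _ ≤ 5 + ∑ i ∈ Finset.Ico 0 k, (4 * Q.m + 5) * q + 1 := by
        gcongr with i
        exact hext i
    _ = 6 + k * (4 * Q.m + 5) * q := by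
        rw [Finset.sum_const, Nat.card_Ico, smul_eq_mul, Nat.sub_zero]
        ring
    _ ≤ (6 + k * (4 * Q.m + 5)) * q := by nlinarith

end StepBound

/-! ## Correctness and step count of the algorithm -/

section Iterators

theorem TrieIter.key_eq {r : ℕ} {it : TrieIter r} {d : Fin r} (h : it.depth = d + 1) :
    it.key = it.keys d := by
  simp only [TrieIter.key, h, d.2, dif_pos]

variable {σ : Type*} {ar : σ → ℕ} {k : ℕ} (Q : Query ar k)

/-- The iterator of the atom `a` stands at the node given by the values of `t` for the
variables before `v_i`. -/
structure Query.AtNode (t : ℕ → ℕ) (i : ℕ) (a : Fin Q.m) (it : TrieIter (ar (Q.rel a))) :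
    Prop where
  depth : it.depth = Q.depthAt a i
  keys : ∀ j, (Q.vars a j : ℕ) < i → it.keys j = t (Q.vars a j)

/-- The iterator of the atom `a` stands among the children of the node given by the values of
`t` for the variables before `v_i`, or behind them. -/
structure Query.BelowNode (t : ℕ → ℕ) (i : ℕ) (a : Fin Q.m) (it : TrieIter (ar (Q.rel a))) :
    Prop where
  depth : it.depth = Q.depthAt a i + 1
  keys : ∀ j, (Q.vars a j : ℕ) < i → it.keys j = t (Q.vars a j)

/-- The iterator of the atom `a` stands at the least key that is at least `lb` among the
children of the node given by the values of `t` for the variables before `v_i`, or at the end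
if there is no such key. -/
structure Query.MovedTo (A : Str ar) (t : ℕ → ℕ) (i : ℕ) (a : Fin Q.m) (lb : ℕ)
    (it : TrieIter (ar (Q.rel a))) : Prop extends Q.BelowNode t i a it where
  lt_of_atEnd : it.atEnd = true → ∀ y ∈ Q.childKeys A t a i, y < lb
  isLeast_key : it.atEnd = false → IsLeast {y | y ∈ Q.childKeys A t a i ∧ lb ≤ y} it.key

variable {Q} {A : Str ar} {t : ℕ → ℕ} {i : ℕ} {a : Fin Q.m} {it : TrieIter (ar (Q.rel a))}

theorem Query.movedTo_place {d : Fin (ar (Q.rel a))} (hd : Q.depthAt a i = d)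
    {keys : Fin (ar (Q.rel a)) → ℕ}
    (hkeys : ∀ j, (Q.vars a j : ℕ) < i → keys j = t (Q.vars a j)) (lb : ℕ) :
    Q.MovedTo A t i a lb (TrieIter.place (A (Q.rel a)) keys d lb) := by
  unfold TrieIter.place
  rw [Query.children_eq_childKeys hd hkeys]
  split_ifs with h
  · refine ⟨⟨by rw [hd], fun j hj => ?_⟩, by simp, fun _ => ?_⟩
    · have hne : j ≠ d := Fin.ne_of_lt (Fin.lt_def.2 (hd ▸ Query.lt_depthAt_iff.2 hj))
      exact (Function.update_of_ne hne _ _).trans (hkeys j hj)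
    · rw [TrieIter.key_eq (d := d) rfl]
      simpa using Finset.isLeast_min' _ h
  · rw [Finset.not_nonempty_iff_eq_empty, Finset.filter_eq_empty_iff] at h
    exact ⟨⟨by rw [hd], hkeys⟩, fun _ y hy => not_le.1 (h hy), by simp⟩

theorem Query.AtNode.down (h : Q.AtNode t i a it) (ha : a ∈ Q.atomsAt i) :
    Q.MovedTo A t i a 0 (it.down (A (Q.rel a))) := by
  have hlt : it.depth < ar (Q.rel a) := h.depth ▸ Query.depthAt_lt_of_mem ha
  rw [TrieIter.down, dif_pos hlt]
  exact Query.movedTo_place h.depth.symm h.keys 0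

theorem Query.BelowNode.seek (h : Q.BelowNode t i a it) (ha : a ∈ Q.atomsAt i) (lb : ℕ) :
    Q.MovedTo A t i a lb (it.seek (A (Q.rel a)) lb) := by
  simp only [TrieIter.seek, h.depth, Query.depthAt_lt_of_mem ha, dif_pos]
  exact Query.movedTo_place rfl h.keys lb

theorem Query.BelowNode.up (h : Q.BelowNode t i a it) : Q.AtNode t i a it.up :=
  ⟨by simp [TrieIter.up, h.depth], h.keys⟩

theorem Query.BelowNode.atNode_update (h : Q.BelowNode t i a it) (ha : a ∈ Q.atomsAt i) :
    Q.AtNode (Function.update t i it.key) (i + 1) a it := by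
  refine ⟨by rw [h.depth, Query.depthAt_succ_of_mem ha], fun j hj => ?_⟩
  rcases Nat.lt_succ_iff_lt_or_eq.1 hj with hj | hj
  · rw [h.keys j hj, Function.update_of_ne hj.ne]
  · rw [hj, Function.update_self, TrieIter.key_eq]
    rw [h.depth, Query.depthAt_eq_of_vars_eq hj]

theorem Query.AtNode.belowNode {x : ℕ} (h : Q.AtNode (Function.update t i x) (i + 1) a it)
    (ha : a ∈ Q.atomsAt i) : Q.BelowNode t i a it ∧ it.key = x := by
  have hd := h.depth
  rw [Query.depthAt_succ_of_mem ha] at hd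
  refine ⟨⟨hd, fun j hj => ?_⟩, ?_⟩
  · rw [h.keys j (by omega), Function.update_of_ne hj.ne]
  · obtain ⟨j, hj⟩ := Query.mem_atomsAt.1 ha
    rw [Query.depthAt_eq_of_vars_eq hj] at hd
    rw [TrieIter.key_eq hd, h.keys j (by omega), hj, Function.update_self]

theorem Query.atNode_update_iff (ha : a ∉ Q.atomsAt i) (x : ℕ) :
    Q.AtNode (Function.update t i x) (i + 1) a it ↔ Q.AtNode t i a it := by
  have hkeys : (∀ j, (Q.vars a j : ℕ) < i + 1 →
      it.keys j = Function.update t i x (Q.vars a j)) ↔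
      ∀ j, (Q.vars a j : ℕ) < i → it.keys j = t (Q.vars a j) := by
    simp only [Query.vars_lt_succ_iff_of_notMem ha]
    exact forall₂_congr fun j hj => by rw [Function.update_of_ne hj.ne]
  exact ⟨fun h => ⟨h.depth.trans (Query.depthAt_succ_of_notMem ha), hkeys.1 h.keys⟩,
    fun h => ⟨h.depth.trans (Query.depthAt_succ_of_notMem ha).symm, hkeys.2 h.keys⟩⟩

end Iterators

section Runs

variable {σ : Type*} {ar : σ → ℕ} {k : ℕ} {Q : Query ar k} {A : Str ar} {τ : IterTime Q}
  {t : ℕ → ℕ} {i n n' : ℕ} {P P' : Finset (Fin k → ℕ)} {c c' c'' : Config Q}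

/-- The configuration `c` with another program position, clock, position of the iterators and
state `J` of the leapfrog join of `v_i`. -/
@[simps]
def Config.onJoin (c : Config Q) (i : ℕ) (pc : PC) (iter : ∀ a, TrieIter (ar (Q.rel a)))
    (J : Join Q.m) (time : ℕ) : Config Q :=
  { c with pc := pc, iter := iter, join := Function.update c.join i J, time := time }

/-- From `c`, the machine reaches `c'` in at most `n` steps, producing every element of `P`
exactly once and leaving the leapfrog joins of the variables before `v_i` alone. -/
structure Runs (A : Str ar) (τ : IterTime Q) (i : ℕ) (P : Finset (Fin k → ℕ)) (n : ℕ)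
    (c c' : Config Q) : Prop where
  steps : ∃ N ≤ n, (step A τ)^[N] c = c'
  join : ∀ j < i, c'.join j = c.join j
  out : ∃ l, c'.out = l ++ c.out ∧ l.Nodup ∧ l.toFinset = P

theorem Runs.of_step (hs : step A τ c = c') (hjoin : ∀ j < i, c'.join j = c.join j)
    (hout : c'.out = c.out) : Runs A τ i ∅ 1 c c' :=
  ⟨⟨1, le_rfl, hs⟩, hjoin, [], hout, List.nodup_nil, rfl⟩

theorem Runs.of_step_eq_onJoin {pc : PC} {iter : ∀ a, TrieIter (ar (Q.rel a))}
    {J : Join Q.m} {T : ℕ} (hs : step A τ c = c.onJoin i pc iter J T) :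
    Runs A τ i ∅ 1 c (c.onJoin i pc iter J T) :=
  .of_step hs (fun _ hj => Function.update_of_ne hj.ne _ _) rfl

theorem Runs.trans (h : Runs A τ i P n c c') (h' : Runs A τ i P' n' c' c'')
    (hP : Disjoint P P') : Runs A τ i (P ∪ P') (n + n') c c'' := by
  obtain ⟨⟨N, hN, hs⟩, hjoin, l, hout, hl, rfl⟩ := h
  obtain ⟨⟨N', hN', hs'⟩, hjoin', l', hout', hl', rfl⟩ := h'
  refine ⟨⟨N' + N, by omega, by rw [Function.iterate_add_apply, hs, hs']⟩,
    fun j hj => (hjoin' j hj).trans (hjoin j hj), l' ++ l, ?_, ?_, ?_⟩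
  · rw [hout', hout, List.append_assoc]
  · exact hl'.append hl (List.disjoint_toFinset_iff_disjoint.1 hP.symm)
  · rw [List.toFinset_append, Finset.union_comm]

theorem Runs.trans_of_empty (h : Runs A τ i ∅ n c c') (h' : Runs A τ i P n' c' c'') :
    Runs A τ i P (n + n') c c'' := by
  simpa only [Finset.empty_union] using h.trans h' (Finset.disjoint_empty_left _)

theorem Runs.mono (h : Runs A τ i P n c c') (hn : n ≤ n') : Runs A τ i P n' c c' :=
  let ⟨N, hN, hs⟩ := h.steps
  { h with steps := ⟨N, hN.trans hn, hs⟩ }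

theorem Runs.of_succ (h : Runs A τ (i + 1) P n c c') : Runs A τ i P n c c' :=
  { h with join := fun j hj => h.join j (hj.trans i.lt_succ_self) }

/-- The machine is at the node `t 0, …, t (i - 1)` of the trie presented by the triejoin. -/
structure AtPrefix (t : ℕ → ℕ) (i : ℕ) (c : Config Q) : Prop where
  level : c.level = i
  perm : ∀ j, (c.join j).iters.Perm (Q.atomsAt j)
  key : ∀ j < i, (c.join j).key = t j
  atNode : ∀ a, Q.AtNode t i a (c.iter a)

/-- From `c`, the machine comes back to the node `t 0, …, t (i - 1)` in at most `n` steps,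
having produced every element of `P` exactly once. -/
def Returns (A : Str ar) (τ : IterTime Q) (t : ℕ → ℕ) (i : ℕ) (P : Finset (Fin k → ℕ)) (n : ℕ)
    (c : Config Q) : Prop :=
  ∃ c', Runs A τ i P n c c' ∧ c'.pc = .advance ∧ AtPrefix t i c'

theorem Returns.mono (h : Returns A τ t i P n c) (hn : n ≤ n') : Returns A τ t i P n' c :=
  let ⟨c', hrun, h⟩ := h
  ⟨c', hrun.mono hn, h⟩

theorem Returns.of_runs (h : Runs A τ i P n c c') (h' : Returns A τ t i P' n' c')
    (hP : Disjoint P P') : Returns A τ t i (P ∪ P') (n + n') c :=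
  let ⟨c'', hrun, h'⟩ := h'
  ⟨c'', h.trans hrun hP, h'⟩

theorem Returns.of_runs_empty (h : Runs A τ i ∅ n c c') (h' : Returns A τ t i P n' c') :
    Returns A τ t i P (n + n') c :=
  let ⟨c'', hrun, hback⟩ := h'
  ⟨c'', h.trans_of_empty hrun, hback⟩

/-- A visit of the node `t 0, …, t (i - 1)` produces the results that extend it, in at most `n`
steps. -/
def VisitReturns (A : Str ar) (τ : IterTime Q) (t : ℕ → ℕ) (i n : ℕ) : Prop :=
  ∀ c : Config Q, c.pc = .visit → AtPrefix t i c → Returns A τ t i (Q.extensions A t i) n c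

/-- The variable `v_i` is open below the node `t 0, …, t (i - 1)`. -/
structure Opened (t : ℕ → ℕ) (i : ℕ) (c : Config Q) : Prop where
  level : c.level = i + 1
  perm : ∀ j, (c.join j).iters.Perm (Q.atomsAt j)
  key : ∀ j < i, (c.join j).key = t j
  atNode : ∀ a ∉ Q.atomsAt i, Q.AtNode t i a (c.iter a)
  belowNode : ∀ a ∈ Q.atomsAt i, Q.BelowNode t i a (c.iter a)

theorem Opened.onJoin (h : Opened t i c) {iter : ∀ a, TrieIter (ar (Q.rel a))} {J : Join Q.m}
    (hJ : J.iters.Perm (Q.atomsAt i)) (hiter : ∀ a ∉ Q.atomsAt i, iter a = c.iter a)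
    (hbelow : ∀ a ∈ Q.atomsAt i, Q.BelowNode t i a (iter a)) (pc : PC) (T : ℕ) :
    Opened t i (c.onJoin i pc iter J T) := by
  refine ⟨h.level, fun j => ?_, fun j hj => ?_, fun a ha => ?_, hbelow⟩
  · obtain rfl | hj := eq_or_ne j i
    · simpa using hJ
    · simpa [hj] using h.perm j
  · simpa [hj.ne] using h.key j hj
  · simpa [hiter a ha] using h.atNode a ha

theorem Opened.returns (h : Opened t i c) (hpc : c.pc = .test)
    (hend : (c.join i).atEnd = true) : Returns A τ t i ∅ 2 c := by
  have hl := h.level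
  have htest : step A τ c = { c with pc := .ascend, time := c.time + 1 } := by
    simp [step, hpc, hl, hend]
  have hascend := Runs.of_step (i := i) (A := A) (τ := τ)
    (c := { c with pc := .ascend, time := c.time + 1 }) rfl (fun j _ => by simp [step])
    (by simp [step])
  refine Returns.of_runs_empty (.of_step htest (fun _ _ => rfl) rfl) ⟨_, hascend, ?_⟩
  refine ⟨by simp [step], by simp [step, hl], by simpa [step] using h.perm,
    by simpa [step] using h.key, fun a => ?_⟩
  simp only [step, hl, Nat.add_sub_cancel]
  split_ifs with ha
  · exact (h.belowNode a ha).up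
  · exact h.atNode a ha

end Runs

section Leapfrog

variable {σ : Type*} {ar : σ → ℕ} {k : ℕ} {Q : Query ar k} {A : Str ar} {τ : IterTime Q}
  {t : ℕ → ℕ} {i x lb : ℕ} {c : Config Q} {a b : Fin Q.m} {l : List (Fin Q.m)}
  {it : TrieIter (ar (Q.rel a))}

/-- The array of iterators of the leapfrog join of `v_i`, read cyclically from the index `p`
on. -/
def rotated (c : Config Q) (i : ℕ) : List (Fin Q.m) :=
  (c.join i).iters.rotate (c.join i).p

theorem rotated_onJoin (pc : PC) (iter : ∀ a, TrieIter (ar (Q.rel a))) (J : Join Q.m) (T : ℕ) :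
    rotated (c.onJoin i pc iter J T) i = J.iters.rotate J.p := by
  simp [rotated]

/-- The invariant of the leapfrog join of `v_i`: no iterator is at its end, and read cyclically
from the index `p` on, the iterators are sorted by key. -/
structure Leapfrogging (A : Str ar) (t : ℕ → ℕ) (i : ℕ) (c : Config Q) : Prop
    extends Opened t i c where
  key_mem : ∀ a ∈ Q.atomsAt i, (c.iter a).key ∈ Q.childKeys A t a i
  atEnd : (c.join i).atEnd = false
  p_lt : (c.join i).p < (c.join i).iters.length
  sorted : (rotated c i).Pairwise fun a b => (c.iter a).key ≤ (c.iter b).key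

/-- The machine is about to execute the loop of leapfrog-search, with `x` as the variable
`x'`. -/
structure Searching (A : Str ar) (t : ℕ → ℕ) (i x : ℕ) (c : Config Q) : Prop
    extends Leapfrogging A t i c where
  pc : c.pc = .loop
  maxKey : (c.join i).maxKey = x
  key_le : ∀ a ∈ Q.atomsAt i, (c.iter a).key ≤ x

theorem Opened.perm_rotated (h : Opened t i c) : (rotated c i).Perm (Q.atomsAt i) :=
  (List.rotate_perm _ _).trans (h.perm i)

theorem Opened.mem_rotated (h : Opened t i c) : a ∈ rotated c i ↔ a ∈ Q.atomsAt i :=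
  h.perm_rotated.mem_iff

theorem Opened.nodup_rotated (h : Opened t i c) : (rotated c i).Nodup :=
  h.perm_rotated.nodup_iff.2 (Query.nodup_atomsAt i)

theorem Opened.length_rotated_le (h : Opened t i c) : (rotated c i).length ≤ Q.m :=
  h.perm_rotated.length_eq.trans_le (Query.length_atomsAt_le i)

theorem Leapfrogging.getElem?_p (h : Leapfrogging A t i c) (hrot : rotated c i = a :: l) :
    (c.join i).iters[(c.join i).p]? = some a := by
  rw [← List.head?_rotate h.p_lt, ← rotated, hrot, List.head?_cons]

theorem Leapfrogging.getElem?_pred_p (h : Leapfrogging A t i c) (hrot : rotated c i = l ++ [a]) :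
    (c.join i).iters[((c.join i).p + (c.join i).iters.length - 1) %
      (c.join i).iters.length]? = some a := by
  have hp := h.p_lt
  have hlast : (rotated c i)[(c.join i).iters.length - 1]? = some a := by
    rw [← List.length_rotate (c.join i).iters (c.join i).p, ← rotated, hrot]
    simp
  rw [rotated, List.getElem?_rotate (by omega)] at hlast
  rw [← hlast]
  congr 2
  omega

theorem Leapfrogging.exists_rotated_eq_cons (h : Leapfrogging A t i c) :
    ∃ a ∈ Q.atomsAt i, ∃ l, rotated c i = a :: l := by
  have hlen : (rotated c i).length ≠ 0 := by
    rw [rotated, List.length_rotate]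
    exact (Nat.zero_le _).trans_lt h.p_lt |>.ne'
  obtain ⟨a, l, hrot⟩ := List.exists_cons_of_length_pos (Nat.pos_of_ne_zero hlen)
  exact ⟨a, h.mem_rotated.1 (hrot ▸ List.mem_cons_self), l, hrot⟩

theorem Leapfrogging.head_key_le (h : Leapfrogging A t i c) (hrot : rotated c i = a :: l)
    (hb : b ∈ Q.atomsAt i) : (c.iter a).key ≤ (c.iter b).key := by
  have hs := h.sorted
  rw [← h.mem_rotated, hrot, List.mem_cons] at hb
  rw [hrot, List.pairwise_cons] at hs
  rcases hb with rfl | hb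
  exacts [le_rfl, hs.1 b hb]

theorem Leapfrogging.key_le_last (h : Leapfrogging A t i c) (hrot : rotated c i = l ++ [a])
    (hb : b ∈ Q.atomsAt i) : (c.iter b).key ≤ (c.iter a).key := by
  have hs := h.sorted
  rw [← h.mem_rotated, hrot, List.mem_append, List.mem_singleton] at hb
  rw [hrot, List.pairwise_append] at hs
  rcases hb with hb | rfl
  exacts [hs.2.2 b hb a (List.mem_singleton.2 rfl), le_rfl]

theorem Leapfrogging.runs_search (h : Leapfrogging A t i c) (hpc : c.pc = .search)
    (hrot : rotated c i = l ++ [a]) :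
    ∃ c', Runs A τ i ∅ 1 c c' ∧ Searching A t i (c.iter a).key c' ∧ rotated c' i = rotated c i ∧
      c'.iter = c.iter := by
  have hl := h.level
  have hget := h.getElem?_pred_p hrot
  have hs : step A τ c = c.onJoin i .loop c.iter { c.join i with maxKey := (c.iter a).key }
      (c.time + 3) := by
    simp [step, hpc, hl, hget, Config.onJoin]
  refine ⟨_, .of_step_eq_onJoin hs, ⟨⟨h.toOpened.onJoin ?_ (fun _ _ => rfl) h.belowNode _ _,
    h.key_mem, by simpa using h.atEnd, by simpa using h.p_lt, ?_⟩, rfl, by simp,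
    fun b hb => h.key_le_last hrot hb⟩, rotated_onJoin _ _ _ _, rfl⟩
  · exact h.perm i
  · rw [rotated_onJoin]
    exact h.sorted

/-- `c` after the iterator `it` of the atom `a`, the one at the index `p`, has been moved and
`p` has been increased. -/
def Config.moved (c : Config Q) (i : ℕ) (pc : PC) (a : Fin Q.m) (it : TrieIter (ar (Q.rel a)))
    (maxKey T : ℕ) : Config Q :=
  c.onJoin i pc (Function.update c.iter a it)
    { c.join i with
      maxKey := maxKey
      p := ((c.join i).p + 1) % (c.join i).iters.length } T

theorem rotated_moved (hrot : rotated c i = a :: l) (pc : PC) (maxKey T : ℕ) :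
    rotated (c.moved i pc a it maxKey T) i = l ++ [a] := by
  rw [Config.moved, rotated_onJoin, List.rotate_mod, ← List.rotate_rotate, ← rotated, hrot]
  simp

theorem Opened.update_iter (h : Opened t i c) (ha : a ∈ Q.atomsAt i)
    (hit : Q.BelowNode t i a it) {J : Join Q.m} (pc : PC) (T : ℕ)
    (hJ : J.iters = (c.join i).iters) :
    Opened t i (c.onJoin i pc (Function.update c.iter a it) J T) := by
  refine h.onJoin (hJ ▸ h.perm i) (fun b hb => ?_) (fun b hb => ?_) pc T
  · exact Function.update_of_ne (ne_of_mem_of_not_mem ha hb).symm _ _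
  · obtain rfl | hba := eq_or_ne b a
    · rwa [Function.update_self]
    · rw [Function.update_of_ne hba]
      exact h.belowNode b hb

theorem key_moved_le (hlb : ∀ b ∈ Q.atomsAt i, (c.iter b).key ≤ lb)
    (hit : lb ≤ it.key) (pc : PC) (maxKey T : ℕ) :
    ∀ b ∈ Q.atomsAt i, ((c.moved i pc a it maxKey T).iter b).key ≤ it.key := by
  intro b hb
  obtain rfl | hba := eq_or_ne b a
  · simp [Config.moved]
  · simpa [Config.moved, hba] using (hlb b hb).trans hit

/-- An iterator with the least key that is moved beyond all others is the last one in the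
cyclic order from then on. -/
theorem Leapfrogging.moved (h : Leapfrogging A t i c) (hrot : rotated c i = a :: l)
    (hlb : ∀ b ∈ Q.atomsAt i, (c.iter b).key ≤ lb) (hit : Q.MovedTo A t i a lb it)
    (hend : it.atEnd = false) (pc : PC) (maxKey T : ℕ) :
    Leapfrogging A t i (c.moved i pc a it maxKey T) := by
  have ha : a ∈ Q.atomsAt i := h.mem_rotated.1 (hrot ▸ List.mem_cons_self)
  have hal : a ∉ l := (List.nodup_cons.1 (hrot ▸ h.nodup_rotated)).1
  have hkey := hit.isLeast_key hend
  refine ⟨h.toOpened.update_iter ha hit.toBelowNode pc T ?_, fun b hb => ?_,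
    by simpa [Config.moved] using h.atEnd, ?_, ?_⟩
  · rfl
  · obtain rfl | hba := eq_or_ne b a
    · simpa [Config.moved] using hkey.1.1
    · simpa [Config.moved, hba] using h.key_mem b hb
  · simpa [Config.moved] using Nat.mod_lt _ ((Nat.zero_le _).trans_lt h.p_lt)
  · have hs := h.sorted
    rw [hrot, List.pairwise_cons] at hs
    rw [rotated_moved hrot, List.pairwise_append]
    refine ⟨hs.2.imp_of_mem fun {b d} hb hd hbd => ?_, List.pairwise_singleton _ _,
      fun b hb d hd => ?_⟩
    · simpa [Config.moved, ne_of_mem_of_not_mem hb hal, ne_of_mem_of_not_mem hd hal] using hbd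
    · obtain rfl := List.mem_singleton.1 hd
      simpa [Config.moved] using key_moved_le hlb hkey.1.2 pc maxKey T b
        (h.mem_rotated.1 (hrot ▸ List.mem_cons_of_mem _ hb))

/-- A bound for the number of moves of the leapfrog join of `v_i` until the iterator of the atom
`b` is at its end: the keys beyond its current one, each preceded by a round of at most `Q.m`
moves, and the number of moves until it is its turn. -/
def potential (A : Str ar) (t : ℕ → ℕ) (i : ℕ) (b : Fin Q.m) (c : Config Q) : ℕ :=
  Q.m * {y ∈ Q.childKeys A t b i | (c.iter b).key < y}.card + (rotated c i).idxOf b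

theorem Leapfrogging.potential_moved_lt (h : Leapfrogging A t i c)
    (hrot : rotated c i = a :: l) (hlb : (c.iter a).key < lb) (hit : Q.MovedTo A t i a lb it)
    (hend : it.atEnd = false) (pc : PC) (maxKey T : ℕ) (hb : b ∈ Q.atomsAt i) :
    potential A t i b (c.moved i pc a it maxKey T) < potential A t i b c := by
  have hlen : l.length < Q.m := by simpa [hrot] using h.length_rotated_le
  have hal : a ∉ l := (List.nodup_cons.1 (hrot ▸ h.nodup_rotated)).1
  rw [potential, potential, rotated_moved hrot, hrot]
  obtain rfl | hba := eq_or_ne b a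
  · have hkey := hit.isLeast_key hend
    have hlt : {y ∈ Q.childKeys A t b i | it.key < y}.card <
        {y ∈ Q.childKeys A t b i | (c.iter b).key < y}.card := by
      have hle := hlb.trans_le hkey.1.2
      refine Finset.card_lt_card (Finset.ssubset_iff_of_subset ?_ |>.2 ⟨it.key, ?_, by simp⟩)
      · exact Finset.monotone_filter_right _ fun y _ hy => hle.trans hy
      · exact Finset.mem_filter.2 ⟨hkey.1.1, hle⟩
    have hmul := Nat.mul_le_mul_left Q.m (Nat.succ_le_of_lt hlt)
    rw [Nat.mul_succ] at hmul
    have hidx : (l ++ [b]).idxOf b = l.length := by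
      rw [List.idxOf_append_of_notMem hal]
      simp
    simp only [Config.moved, Config.onJoin_iter, Function.update_self, hidx,
      List.idxOf_cons_self]
    omega
  · have hbl : b ∈ l := by simpa [hrot, hba] using h.mem_rotated.2 hb
    rw [List.idxOf_append_of_mem hbl, List.idxOf_cons_ne _ hba.symm]
    simp [Config.moved, hba]

end Leapfrog

section Search

variable {σ : Type*} {ar : σ → ℕ} {k : ℕ} {Q : Query ar k} {A : Str ar} {τ : IterTime Q}
  {t : ℕ → ℕ} {i x lb n : ℕ} {c : Config Q} {a b : Fin Q.m} {l : List (Fin Q.m)}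

/-- The next step of the leapfrog join of `v_i` is to move the iterator of the atom `a` to the
least key that is at least `lb`, as part of leapfrog-search or of leapfrog-next. -/
structure Seeks (A : Str ar) (τ : IterTime Q) (i : ℕ) (a : Fin Q.m) (lb : ℕ) (c : Config Q) :
    Prop where
  of_atEnd : ((c.iter a).seek (A (Q.rel a)) lb).atEnd = true →
    ∃ T, step A τ c = c.onJoin i .test
      (Function.update c.iter a ((c.iter a).seek (A (Q.rel a)) lb))
      { c.join i with atEnd := true } T
  of_not_atEnd : ((c.iter a).seek (A (Q.rel a)) lb).atEnd = false →
    ∃ pc maxKey T,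
      step A τ c = c.moved i pc a ((c.iter a).seek (A (Q.rel a)) lb) maxKey T ∧
      (pc = .loop ∧ maxKey = ((c.iter a).seek (A (Q.rel a)) lb).key ∨ pc = .search)

theorem Searching.seeks (h : Searching A t i x c) (hrot : rotated c i = a :: l)
    (hne : (c.iter a).key ≠ x) : Seeks A τ i a x c := by
  have hl := h.level
  have hget := h.getElem?_p hrot
  have hpc := h.pc
  have hmax := h.maxKey
  refine ⟨fun hend => ⟨c.time + 5 + τ c a .seek, ?_⟩,
    fun hend => ⟨.loop, _, c.time + 7 + τ c a .seek, ?_, .inl ⟨rfl, rfl⟩⟩⟩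
  all_goals simp [step, hpc, hl, hget, hmax, hne, hend, Config.moved, Config.onJoin]

theorem Leapfrogging.seeks_key_add_one (h : Leapfrogging A t i c) (hpc : c.pc = .advance)
    (hrot : rotated c i = a :: l) : Seeks A τ i a ((c.iter a).key + 1) c := by
  have hl := h.level
  have hget := h.getElem?_p hrot
  refine ⟨fun hend => ⟨c.time + 4 + τ c a .next, ?_⟩,
    fun hend => ⟨.search, (c.join i).maxKey, c.time + 4 + τ c a .next, ?_, .inr rfl⟩⟩
  all_goals simp [step, hpc, hl, hget, TrieIter.next, hend, Config.moved, Config.onJoin]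

theorem Leapfrogging.returns_of_seek_atEnd (hi : i < k) (h : Leapfrogging A t i c)
    (hrot : rotated c i = a :: l) (hseeks : Seeks A τ i a lb c)
    (hend : ((c.iter a).seek (A (Q.rel a)) lb).atEnd = true) :
    Returns A τ t i (Q.extensionsFrom A t i lb) 3 c := by
  have ha : a ∈ Q.atomsAt i := h.mem_rotated.1 (hrot ▸ List.mem_cons_self)
  have hit := (h.belowNode a ha).seek (A := A) ha lb
  obtain ⟨T, hs⟩ := hseeks.of_atEnd hend
  rw [Query.extensionsFrom_eq_empty hi ha (hit.lt_of_atEnd hend)]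
  exact .of_runs_empty (.of_step_eq_onJoin hs)
    ((h.toOpened.update_iter ha hit.toBelowNode _ _ (by rfl)).returns rfl (by simp))

theorem Leapfrogging.runs_seek (h : Leapfrogging A t i c) (hrot : rotated c i = a :: l)
    (hlb : ∀ b ∈ Q.atomsAt i, (c.iter b).key ≤ lb) (hlt : (c.iter a).key < lb)
    (hseeks : Seeks A τ i a lb c)
    (hend : ((c.iter a).seek (A (Q.rel a)) lb).atEnd = false) :
    ∃ c', Runs A τ i ∅ 2 c c' ∧
      Searching A t i ((c.iter a).seek (A (Q.rel a)) lb).key c' ∧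
      ∀ b ∈ Q.atomsAt i, potential A t i b c' < potential A t i b c := by
  have ha : a ∈ Q.atomsAt i := h.mem_rotated.1 (hrot ▸ List.mem_cons_self)
  have hit := (h.belowNode a ha).seek (A := A) ha lb
  obtain ⟨pc, maxKey, T, hs, hpc⟩ := hseeks.of_not_atEnd hend
  generalize (c.iter a).seek (A (Q.rel a)) lb = it at *
  have hmoved := h.moved hrot hlb hit hend pc maxKey T
  have hrun : Runs A τ i ∅ 1 c (c.moved i pc a it maxKey T) := .of_step_eq_onJoin hs
  have hpot := fun b hb => h.potential_moved_lt hrot hlt hit hend pc maxKey T (b := b) hb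
  rcases hpc with ⟨rfl, rfl⟩ | rfl
  · exact ⟨_, hrun.mono one_le_two, ⟨hmoved, rfl, by simp [Config.moved],
      key_moved_le hlb (hit.isLeast_key hend).1.2 _ _ _⟩, hpot⟩
  · obtain ⟨c', hrun', hsearch, hrot', hiter⟩ :=
      hmoved.runs_search (τ := τ) rfl (rotated_moved hrot _ _ _)
    have hkey : ((c.moved i .search a it maxKey T).iter a).key = it.key := by
      simp [Config.moved]
    refine ⟨c', hrun.trans_of_empty hrun', hkey ▸ hsearch,
      fun b hb => lt_of_eq_of_lt ?_ (hpot b hb)⟩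
    rw [potential, potential, hrot', hiter]

theorem Opened.atPrefix (h : Opened t i c) (hkey : (c.join i).key = x)
    (hx : ∀ a ∈ Q.atomsAt i, (c.iter a).key = x) :
    AtPrefix (Function.update t i x) (i + 1) c := by
  refine ⟨h.level, h.perm, fun j hj => ?_, fun a => ?_⟩
  · rcases Nat.lt_succ_iff_lt_or_eq.1 hj with hj | rfl
    · rw [Function.update_of_ne hj.ne, h.key j hj]
    · rw [Function.update_self, hkey]
  · by_cases ha : a ∈ Q.atomsAt i
    · exact hx a ha ▸ (h.belowNode a ha).atNode_update ha
    · exact (Query.atNode_update_iff ha x).2 (h.atNode a ha)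

theorem AtPrefix.opened (h : AtPrefix (Function.update t i x) (i + 1) c) :
    Opened t i c ∧ ∀ a ∈ Q.atomsAt i, (c.iter a).key = x := by
  refine ⟨⟨h.level, h.perm, fun j hj => ?_, fun a ha => ?_,
    fun a ha => ((h.atNode a).belowNode ha).1⟩, fun a ha => ((h.atNode a).belowNode ha).2⟩
  · rw [h.key j (hj.trans i.lt_succ_self), Function.update_of_ne hj.ne]
  · exact (Query.atNode_update_iff ha x).1 (h.atNode a)

theorem Searching.key_eq (h : Searching A t i x c) (hrot : rotated c i = a :: l)
    (hkey : (c.iter a).key = x) : ∀ b ∈ Q.atomsAt i, (c.iter b).key = x := fun b hb =>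
  (h.key_le b hb).antisymm (hkey ▸ h.head_key_le hrot hb)

theorem Searching.runs_visit (h : Searching A t i x c) (hrot : rotated c i = a :: l)
    (hkey : (c.iter a).key = x) :
    ∃ c', Runs A τ i ∅ 2 c c' ∧ c'.pc = .visit ∧
      AtPrefix (Function.update t i x) (i + 1) c' ∧
      c'.join i = { c.join i with key := x } := by
  have hl := h.level
  have hget := h.getElem?_p hrot
  have hpc := h.pc
  have hmax := h.maxKey
  have hend := h.atEnd
  have hloop : step A τ c = c.onJoin i .test c.iter { c.join i with key := x } (c.time + 4) := by
    simp [step, hpc, hl, hget, hmax, hkey, Config.onJoin]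
  have htest : step A τ (c.onJoin i .test c.iter { c.join i with key := x } (c.time + 4)) =
      c.onJoin i .visit c.iter { c.join i with key := x } (c.time + 4 + 1) := by
    simp [step, hl, hend, Config.onJoin]
  refine ⟨_, (Runs.of_step_eq_onJoin hloop).trans_of_empty
    (.of_step htest (fun _ _ => rfl) rfl), rfl, ?_, by simp⟩
  refine Opened.atPrefix (h.toOpened.onJoin ?_ (fun _ _ => rfl) h.belowNode _ _) (by simp)
    (h.key_eq hrot hkey)
  exact h.perm i

theorem Searching.runs_advance (h : Searching A t i x c) (hrot : rotated c i = a :: l)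
    (hkey : (c.iter a).key = x) (hvisit : VisitReturns A τ (Function.update t i x) (i + 1) n) :
    ∃ c', Runs A τ i (Q.extensions A (Function.update t i x) (i + 1)) (2 + n) c c' ∧
      c'.pc = .advance ∧ Leapfrogging A t i c' ∧ rotated c' i = rotated c i ∧
      ∀ b ∈ Q.atomsAt i, (c'.iter b).key = x := by
  have hx := h.key_eq hrot hkey
  obtain ⟨c', hrun, hpc, hat, hjoin⟩ := h.runs_visit (τ := τ) hrot hkey
  obtain ⟨c'', hrun', hpc', hat'⟩ := hvisit c' hpc hat
  obtain ⟨hopen, hx'⟩ := hat'.opened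
  rw [← hrun'.join i i.lt_succ_self] at hjoin
  refine ⟨c'', hrun.trans_of_empty hrun'.of_succ, hpc',
    ⟨hopen, fun b hb => ?_, by simpa [hjoin] using h.atEnd, by simpa [hjoin] using h.p_lt, ?_⟩,
    by simp [rotated, hjoin], hx'⟩
  · rw [hx' b hb, ← hx b hb]
    exact h.key_mem b hb
  · refine List.Pairwise.imp_of_mem (R := fun _ _ => True) (fun {b d} hb hd _ => ?_)
      (List.pairwise_of_forall fun _ _ => trivial)
    rw [hx' b (hopen.mem_rotated.1 hb), hx' d (hopen.mem_rotated.1 hd)]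

theorem Leapfrogging.returns_of_seeks (hi : i < k) (h : Leapfrogging A t i c)
    (hrot : rotated c i = a :: l) (hlb : ∀ b ∈ Q.atomsAt i, (c.iter b).key ≤ lb)
    (hlt : (c.iter a).key < lb) (hseeks : Seeks A τ i a lb c) (hb : b ∈ Q.atomsAt i)
    {w : ℕ → ℕ} (ih : ∀ y c', potential A t i b c' < potential A t i b c →
      Searching A t i y c' → Returns A τ t i (Q.extensionsFrom A t i y)
        (4 * potential A t i b c' + 5 + ∑ z ∈ Q.commonKeys A t i with y ≤ z, w z) c') :
    Returns A τ t i (Q.extensionsFrom A t i lb)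
      (4 * potential A t i b c + 3 + ∑ z ∈ Q.commonKeys A t i with lb ≤ z, w z) c := by
  rcases hend : ((c.iter a).seek (A (Q.rel a)) lb).atEnd
  · have ha : a ∈ Q.atomsAt i := h.mem_rotated.1 (hrot ▸ List.mem_cons_self)
    have hleast := ((h.belowNode a ha).seek (A := A) ha lb).isLeast_key hend
    obtain ⟨c', hrun, hsearch, hpot⟩ := h.runs_seek hrot hlb hlt hseeks hend
    rw [Query.extensionsFrom_eq_of_isLeast hi ha hleast]
    refine (Returns.of_runs_empty hrun (ih _ c' (hpot b hb) hsearch)).mono ?_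
    have hsum := Finset.sum_le_sum_of_subset (f := w) (Finset.monotone_filter_right
      (p := (_ ≤ ·)) (q := (lb ≤ ·)) (Q.commonKeys A t i) fun _ _ => hleast.1.2.trans)
    have hpot := hpot b hb
    omega
  · exact (h.returns_of_seek_atEnd hi hrot hseeks hend).mono (by omega)

/-- Every move of an iterator decreases the potential and takes at most two steps; at most two
more are spent on presenting a key before it. Hence the factor `4`. -/
theorem Searching.returns (hi : i < k) {w : ℕ → ℕ}
    (hvisit : ∀ x ∈ Q.commonKeys A t i,
      VisitReturns A τ (Function.update t i x) (i + 1) (w x))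
    (hb : b ∈ Q.atomsAt i) (h : Searching A t i x c) :
    Returns A τ t i (Q.extensionsFrom A t i x)
      (4 * potential A t i b c + 5 + ∑ y ∈ Q.commonKeys A t i with x ≤ y, w y) c := by
  induction hpot : potential A t i b c using Nat.strong_induction_on generalizing x c with
  | _ p ih =>
    subst hpot
    obtain ⟨a, ha, l, hrot⟩ := h.exists_rotated_eq_cons
    by_cases hkey : (c.iter a).key = x
    · have hx : x ∈ Q.commonKeys A t i := (Query.mem_commonKeys hi).2 fun d hd =>
        h.key_eq hrot hkey d hd ▸ h.key_mem d hd
      obtain ⟨c', hrun, hpc, hleap, hrot', hkeys⟩ := h.runs_advance hrot hkey (hvisit x hx)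
      have hpot : potential A t i b c' = potential A t i b c := by
        rw [potential, potential, hrot', hkeys b hb, h.key_eq hrot hkey b hb]
      rw [hrot] at hrot'
      have hrest := hleap.returns_of_seeks hi hrot' (lb := x + 1)
        (fun d hd => (hkeys d hd).trans_le x.le_succ) ((hkeys a ha).trans_lt x.lt_succ_self)
        (hkeys a ha ▸ hleap.seeks_key_add_one hpc hrot') hb
        fun y d hd hsearch => ih _ (hpot ▸ hd) hsearch rfl
      have hsum : ∑ y ∈ Q.commonKeys A t i with x ≤ y, w y =
          w x + ∑ y ∈ Q.commonKeys A t i with x + 1 ≤ y, w y := by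
        rw [← Finset.sum_insert (by simp)]
        congr 1
        ext y
        grind
      rw [Query.extensionsFrom_eq_union hi]
      exact (Returns.of_runs hrun hrest
        (Query.disjoint_extensions_update_extensionsFrom hi A t x)).mono (by omega)
    · refine (h.returns_of_seeks hi hrot h.key_le (lt_of_le_of_ne (h.key_le a ha) hkey)
        (h.seeks hrot hkey) hb fun y d hd hsearch => ih _ hd hsearch rfl).mono (by omega)

end Search

section Visit

variable {σ : Type*} {ar : σ → ℕ} {k : ℕ} {Q : Query ar k} {A : Str ar} {τ : IterTime Q}
  {t : ℕ → ℕ} {i : ℕ} {c : Config Q} {b : Fin Q.m}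

theorem Query.Consistent.visitReturns (h : Q.Consistent A t k) : VisitReturns A τ t k 1 := by
  intro c hpc hat
  have hl := hat.level
  have hs : step A τ c =
      { c with
        out := (fun v => (c.join v).key) :: c.out
        pc := .advance
        time := c.time + (k + 2) } := by
    simp [step, hpc, hl]
  have ht : (fun v : Fin k => (c.join v).key) = fun v : Fin k => t v :=
    funext fun v => hat.key v v.2
  refine ⟨_, ⟨⟨1, le_rfl, hs⟩, fun _ _ => rfl, [fun v => (c.join v).key], rfl,
    List.nodup_singleton _, ?_⟩, rfl, ⟨hat.level, hat.perm, hat.key, hat.atNode⟩⟩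
  rw [h.extensions_eq_singleton, ht]
  rfl

theorem AtPrefix.runs_descend (hi : i < k) (hpc : c.pc = .visit) (h : AtPrefix t i c) :
    ∃ c', Runs A τ i ∅ 2 c c' ∧ c'.pc = .init ∧ Opened t i c' ∧
      ∀ a ∈ Q.atomsAt i, Q.MovedTo A t i a 0 (c'.iter a) := by
  have hl := h.level
  have hvisit : step A τ c = { c with pc := .descend, time := c.time + 1 } := by
    simp [step, hpc, hl, hi.ne]
  refine ⟨step A τ { c with pc := .descend, time := c.time + 1 },
    (Runs.of_step hvisit (fun _ _ => rfl) rfl).trans_of_empty (.of_step rfl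
      (fun _ _ => rfl) rfl), rfl, ⟨by simp [step, hl], h.perm, h.key, fun a ha => ?_,
    fun a ha => ?_⟩, fun a ha => ?_⟩
  · simpa [step, hl, ha] using h.atNode a
  · simpa [step, hl, ha] using ((h.atNode a).down (A := A) ha).toBelowNode
  · simpa [step, hl, ha] using (h.atNode a).down (A := A) ha

theorem Opened.returns_of_iter_atEnd (hi : i < k) (hpc : c.pc = .init) (h : Opened t i c)
    (hb : b ∈ Q.atomsAt i) (hmoved : Q.MovedTo A t i b 0 (c.iter b))
    (hend : (c.iter b).atEnd = true) : Returns A τ t i (Q.extensions A t i) 3 c := by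
  have hl := h.level
  have hany : ((c.join i).iters.any fun a => (c.iter a).atEnd) = true :=
    List.any_eq_true.2 ⟨b, (h.perm i).mem_iff.2 hb, hend⟩
  have hs : step A τ c = c.onJoin i .test c.iter { c.join i with atEnd := true }
      (c.time + ((c.join i).iters.length + 2)) := by
    simp only [step, hpc, hl, Nat.add_sub_cancel, hany, if_true, Config.onJoin]
  rw [← Query.extensionsFrom_zero,
    Query.extensionsFrom_eq_empty hi hb (hmoved.lt_of_atEnd hend)]
  refine .of_runs_empty (.of_step_eq_onJoin hs)
    ((h.onJoin ?_ (fun _ _ => rfl) h.belowNode _ _).returns rfl (by simp))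
  exact h.perm i

theorem Opened.runs_init (hi : i < k) (hpc : c.pc = .init) (h : Opened t i c)
    (hkey : ∀ a ∈ Q.atomsAt i, (c.iter a).key ∈ Q.childKeys A t a i)
    (hend : ∀ a ∈ Q.atomsAt i, (c.iter a).atEnd = false) :
    ∃ c', Runs A τ i ∅ 1 c c' ∧ c'.pc = .search ∧ Leapfrogging A t i c' ∧
      c'.iter = c.iter := by
  have hl := h.level
  have hany : ¬ ((c.join i).iters.any fun a => (c.iter a).atEnd) = true := by
    simpa [(h.perm i).mem_iff] using hend
  let r : Fin Q.m → Fin Q.m → Prop := fun a b => (c.iter a).key ≤ (c.iter b).key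
  have : IsTrans (Fin Q.m) r := ⟨fun _ _ _ => le_trans⟩
  have : Std.Total r := ⟨fun _ _ => le_total _ _⟩
  have hs : step A τ c = c.onJoin i .search c.iter
      { c.join i with
        iters := (c.join i).iters.insertionSort r
        p := 0
        atEnd := false }
      (c.time + ((c.join i).iters.length + 3 + (c.join i).iters.length ^ 2)) := by
    simp only [step, hpc, hl, Nat.add_sub_cancel, Config.onJoin]
    rw [if_neg hany]
  have hperm : ((c.join i).iters.insertionSort r).Perm (Q.atomsAt i) :=
    (List.perm_insertionSort r _).trans (h.perm i)
  obtain ⟨a, ha⟩ := Query.exists_mem_atomsAt (Q := Q) hi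
  refine ⟨_, .of_step_eq_onJoin hs, rfl, ⟨h.onJoin hperm (fun _ _ => rfl) h.belowNode _ _,
    hkey, by simp, ?_, ?_⟩, rfl⟩
  · simpa using List.length_pos_of_mem ((h.perm i).mem_iff.2 ha)
  · rw [rotated_onJoin, List.rotate_zero]
    exact List.pairwise_insertionSort r _

theorem Opened.potential_lt (h : Opened t i c) (hb : b ∈ Q.atomsAt i)
    (hkey : (c.iter b).key ∈ Q.childKeys A t b i) :
    potential A t i b c < Q.m * (Q.childKeys A t b i).card := by
  have hidx : (rotated c i).idxOf b < Q.m :=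
    (List.idxOf_lt_length_iff.2 (h.mem_rotated.2 hb)).trans_le h.length_rotated_le
  have hcard : {y ∈ Q.childKeys A t b i | (c.iter b).key < y}.card <
      (Q.childKeys A t b i).card :=
    Finset.card_lt_card (Finset.filter_ssubset.2 ⟨_, hkey, lt_irrefl _⟩)
  have hmul := Nat.mul_le_mul_left Q.m (Nat.succ_le_of_lt hcard)
  rw [Nat.mul_succ] at hmul
  unfold potential
  omega

theorem Opened.returns_of_init (hi : i < k) (hpc : c.pc = .init) (h : Opened t i c)
    (hmoved : ∀ a ∈ Q.atomsAt i, Q.MovedTo A t i a 0 (c.iter a)) {w : ℕ → ℕ}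
    (hvisit : ∀ x ∈ Q.commonKeys A t i,
      VisitReturns A τ (Function.update t i x) (i + 1) (w x)) :
    Returns A τ t i (Q.extensions A t i)
      (4 * (Q.m * Q.fanout A t i) + 3 + ∑ x ∈ Q.commonKeys A t i, w x) c := by
  by_cases hend : ∀ a ∈ Q.atomsAt i, (c.iter a).atEnd = false
  · have hleast := fun a ha => (hmoved a ha).isLeast_key (hend a ha)
    obtain ⟨b, hb, hfanout⟩ := Query.exists_card_childKeys_eq_fanout hi A t
    obtain ⟨c', hrun, hpc', h', hiter⟩ :=
      h.runs_init (A := A) (τ := τ) hi hpc (fun a ha => (hleast a ha).1.1) hend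
    have hne : rotated c' i ≠ [] := List.ne_nil_of_mem (h'.mem_rotated.2 hb)
    have hlast := (List.dropLast_append_getLast hne).symm
    obtain ⟨c'', hrun', hsearch, hrot, hiter'⟩ := h'.runs_search (τ := τ) hpc' hlast
    have hz : (rotated c' i).getLast hne ∈ Q.atomsAt i :=
      h'.mem_rotated.1 (List.getLast_mem hne)
    have hpot := hsearch.potential_lt (A := A) hb (hsearch.key_mem b hb)
    rw [hfanout] at hpot
    have hsum : ∑ x ∈ Q.commonKeys A t i with (c.iter ((rotated c' i).getLast hne)).key ≤ x,
        w x ≤ ∑ x ∈ Q.commonKeys A t i, w x :=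
      Finset.sum_le_sum_of_subset (Finset.filter_subset _ _)
    rw [hiter] at hsearch
    rw [← Query.extensionsFrom_zero, Query.extensionsFrom_eq_of_isLeast hi hz (hleast _ hz)]
    exact (Returns.of_runs_empty (hrun.trans_of_empty hrun')
      (hsearch.returns hi hvisit hb)).mono (by omega)
  · push Not at hend
    obtain ⟨a, ha, hend⟩ := hend
    rw [ne_eq, Bool.not_eq_false] at hend
    exact (h.returns_of_iter_atEnd hi hpc ha (hmoved a ha) hend).mono (by omega)

theorem Query.Consistent.visitReturns_stepBound (n : ℕ) (hin : i + n = k)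
    (h : Q.Consistent A t i) : VisitReturns A τ t i (Q.stepBound A n i t) := by
  induction n generalizing i t with
  | zero =>
    obtain rfl : i = k := hin
    exact h.visitReturns
  | succ n ih =>
    have hi : i < k := by omega
    intro c hpc hat
    obtain ⟨c', hrun, hpc', hopen, hmoved⟩ := hat.runs_descend (A := A) (τ := τ) hi hpc
    have hvisit : ∀ x ∈ Q.commonKeys A t i, VisitReturns A τ (Function.update t i x) (i + 1)
        (Q.stepBound A n (i + 1) (Function.update t i x)) := fun x hx =>
      ih (by omega) (h.update ((Query.mem_commonKeys hi).1 hx))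
    refine (Returns.of_runs_empty hrun (hopen.returns_of_init hi hpc' hmoved hvisit)).mono ?_
    rw [Query.stepBound]
    omega

theorem atPrefix_start (t : ℕ → ℕ) : AtPrefix t 0 (start Q) :=
  ⟨rfl, fun _ => List.Perm.refl _, fun j hj => absurd hj j.not_lt_zero, fun a =>
    ⟨(Query.depthAt_zero a).symm, fun _ hj => absurd hj (Nat.not_lt_zero _)⟩⟩

theorem exists_halt_le_stepBound (A : Str ar) (τ : IterTime Q) (t : ℕ → ℕ) :
    ∃ N ≤ Q.stepBound A k 0 t + 1, HaltsAt A τ ((step A τ)^[N] (start Q)) ∧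
      ((step A τ)^[N] (start Q)).out.Nodup ∧
      ∀ s, s ∈ ((step A τ)^[N] (start Q)).out ↔ s ∈ Q.result A := by
  obtain ⟨c, hrun, hpc, hat⟩ := (Query.consistent_zero A t).visitReturns_stepBound (τ := τ)
    k (Nat.zero_add k) (start Q) rfl (atPrefix_start t)
  obtain ⟨N, hN, rfl⟩ := hrun.steps
  obtain ⟨l, hout, hl, hmem⟩ := hrun.out
  have hlevel := hat.level
  have hstart : (start Q).out = [] := rfl
  rw [hstart, List.append_nil] at hout
  have hs : step A τ ((step A τ)^[N] (start Q)) = { (step A τ)^[N] (start Q) with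
      pc := .halt, time := ((step A τ)^[N] (start Q)).time + 1 } := by
    simp [step, hpc, hlevel]
  refine ⟨N + 1, Nat.add_le_add_right hN 1, ⟨?_, N + 1, rfl⟩, ?_⟩
  · rw [Function.iterate_succ_apply', hs]
  · rw [Function.iterate_succ_apply', hs]
    refine ⟨hout ▸ hl, fun s => ?_⟩
    rw [← Query.mem_extensions_zero (t := t), ← hmem, List.mem_toFinset, hout]

end Visit

/-! ## Running time of the steps -/

section Time

variable {σ : Type*} {ar : σ → ℕ} {k : ℕ} {Q : Query ar k} {A : Str ar} {τ : IterTime Q}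
  {c : Config Q}

theorem length_iters_step_le (h : ∀ j, (c.join j).iters.length ≤ Q.m) (j : ℕ) :
    ((step A τ c).join j).iters.length ≤ Q.m := by
  have hupdate : ∀ J : Join Q.m, J.iters.length ≤ Q.m → ∀ i,
      (Function.update c.join i J j).iters.length ≤ Q.m := by
    intro J hJ i
    rcases eq_or_ne j i with rfl | hj
    · rwa [Function.update_self]
    · rw [Function.update_of_ne hj]
      exact h j
  unfold step
  dsimp only
  split <;> (try split) <;> (try split) <;> (try split) <;>
    first
    | exact h j
    | exact hupdate _ (by exact h (c.level - 1)) _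
    | exact hupdate _ (by exact (List.length_insertionSort _ _).trans_le (h (c.level - 1))) _

theorem sum_iterTime_le {T : ℕ} (hT : ∀ a op, τ c a op ≤ T) (i : ℕ) (op : IterOp) :
    ((Q.atomsAt i).map fun a => 1 + τ c a op).sum ≤ Q.m * (1 + T) := by
  refine (List.sum_le_card_nsmul _ (1 + T) fun x hx => ?_).trans ?_
  · obtain ⟨a, -, rfl⟩ := List.mem_map.1 hx
    exact Nat.add_le_add_left (hT a op) 1
  · rw [List.length_map, smul_eq_mul]
    exact Nat.mul_le_mul_right _ (Query.length_atomsAt_le i)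

theorem time_step_le (h : ∀ j, (c.join j).iters.length ≤ Q.m) {T : ℕ}
    (hT : ∀ a op, τ c a op ≤ T) :
    (step A τ c).time ≤ c.time + ((Q.m + 1) * T + (Q.m + 1) ^ 2 + k + 6) := by
  have hlen := h (c.level - 1)
  have hsq := Nat.pow_le_pow_left hlen 2
  rw [show (Q.m + 1) * T + (Q.m + 1) ^ 2 + k + 6 =
    Q.m * (1 + T) + T + Q.m ^ 2 + Q.m + k + 7 by ring]
  cases hpc : c.pc <;> simp only [step, hpc]
  case visit => split <;> dsimp only <;> omega
  case descend =>
    have hdown := sum_iterTime_le hT c.level .down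
    omega
  case init => split <;> dsimp only <;> omega
  case search => split <;> dsimp only <;> omega
  case loop =>
    rcases (c.join (c.level - 1)).iters[(c.join (c.level - 1)).p]? with _ | a
    · exact Nat.le_add_right _ _
    · have hseek := hT a .seek
      dsimp only
      split_ifs <;> dsimp only <;> omega
  case test => split <;> dsimp only <;> omega
  case ascend =>
    have hup := sum_iterTime_le hT (c.level - 1) .up
    omega
  case advance =>
    rcases (c.join (c.level - 1)).iters[(c.join (c.level - 1)).p]? with _ | a
    · split_ifs <;> dsimp only <;> omega
    · have hnext := hT a .next
      dsimp only
      split_ifs <;> dsimp only <;> omega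
  case halt => exact Nat.le_add_right _ _

theorem time_iterate_step_le {T : ℕ} (hT : ∀ c a op, τ c a op ≤ T) (n : ℕ) :
    ((step A τ)^[n] (start Q)).time ≤ n * ((Q.m + 1) * T + (Q.m + 1) ^ 2 + k + 6) := by
  suffices (∀ j, (((step A τ)^[n] (start Q)).join j).iters.length ≤ Q.m) ∧
      ((step A τ)^[n] (start Q)).time ≤ n * ((Q.m + 1) * T + (Q.m + 1) ^ 2 + k + 6) from this.2
  induction n with
  | zero => exact ⟨fun j => Query.length_atomsAt_le j, Nat.zero_le _⟩
  | succ n ih =>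
    rw [Function.iterate_succ_apply', Nat.succ_mul]
    exact ⟨length_iters_step_le ih.1,
      (time_step_le ih.1 (hT _)).trans (Nat.add_le_add_right ih.2 _)⟩

theorem IterTime.Meets.le_floor {κ : ℝ} (hτ : τ.Meets κ A) {M : ℕ}
    (hM : ∀ a, (A (Q.rel a)).card ≤ M) (c : Config Q) (a : Fin Q.m) (op : IterOp) :
    τ c a op ≤ ⌊|κ| * max 1 (Real.logb 2 M)⌋₊ := by
  refine Nat.le_floor ((hτ c a op).trans ?_)
  refine mul_le_mul (le_abs_self κ) (max_le (le_max_left _ _) ?_)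
    (zero_le_one.trans (le_max_left _ _)) (abs_nonneg κ)
  rcases Nat.eq_zero_or_pos (A (Q.rel a)).card with h | h
  · simp [h]
  · exact (Real.logb_le_logb_of_le one_lt_two (by exact_mod_cast h)
      (by exact_mod_cast hM a)).trans (le_max_right _ _)

theorem IterTime.Meets.time_iterate_step_le {κ : ℝ} (hτ : τ.Meets κ A) {M : ℕ}
    (hM : ∀ a, (A (Q.rel a)).card ≤ M) (n : ℕ) :
    (((step A τ)^[n] (start Q)).time : ℝ) ≤
      n * (((Q.m + 1) * |κ| + (Q.m + 1) ^ 2 + k + 6) * max 1 (Real.logb 2 M)) := by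
  set L := max 1 (Real.logb 2 M)
  have hL : 1 ≤ L := le_max_left _ _
  have hfloor : (⌊|κ| * L⌋₊ : ℝ) ≤ |κ| * L := Nat.floor_le (by positivity)
  have hiter : ((Q.m : ℝ) + 1) * ⌊|κ| * L⌋₊ ≤ (Q.m + 1) * (|κ| * L) := by gcongr
  have hrest : ((Q.m + 1) ^ 2 + k + 6 : ℝ) ≤ ((Q.m + 1) ^ 2 + k + 6) * L :=
    le_mul_of_one_le_right (by positivity) hL
  calc (((step A τ)^[n] (start Q)).time : ℝ)
    _ ≤ n * ((Q.m + 1) * ⌊|κ| * L⌋₊ + (Q.m + 1) ^ 2 + k + 6) :=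
      mod_cast LFTJ.time_iterate_step_le (hτ.le_floor hM) n
    _ ≤ n * (((Q.m + 1) * |κ| + (Q.m + 1) ^ 2 + k + 6) * L) :=
      mul_le_mul_of_nonneg_left (by linarith) n.cast_nonneg

end Time

end LFTJ

theorem mainTheorem1_general {σ : Type*} {ar : σ → ℕ} {k : ℕ} (Q : LFTJ.Query ar k) (κ : ℝ) :
    ∃ C : ℝ, ∀ (A : LFTJ.Str ar) (τ : LFTJ.IterTime Q), τ.Meets κ A →
      ∃ c : LFTJ.Config Q, LFTJ.HaltsAt A τ c ∧
        c.out.Nodup ∧ (∀ t, t ∈ c.out ↔ t ∈ Q.result A) ∧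
        ∀ (𝒦 : Set (LFTJ.Str ar)) (q M : ℕ), LFTJ.ClosedUnderRenumbering 𝒦 →
          (∀ B ∈ 𝒦, (Q.result B).ncard ≤ q) →
          (∀ a, (A (Q.rel a)).card ≤ M) →
          (∃ B ∈ 𝒦, ∀ a, A (Q.rel a) ⊆ B (Q.rel a) ∧ (B (Q.rel a)).Nonempty) →
          (c.time : ℝ) ≤ C * q * max 1 (Real.logb 2 M) := by
  refine ⟨(6 + k * (4 * Q.m + 5)) * ((Q.m + 1) * |κ| + (Q.m + 1) ^ 2 + k + 6),
    fun A τ hτ => ?_⟩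
  obtain ⟨N, hN, hhalt, hnodup, hmem⟩ := LFTJ.exists_halt_le_stepBound A τ fun _ => 0
  refine ⟨_, hhalt, hnodup, hmem, fun 𝒦 q M h𝒦 hq hM ⟨B, hBK, hB⟩ => ?_⟩
  have hsteps : (N : ℝ) ≤ (6 + k * (4 * Q.m + 5)) * q :=
    mod_cast hN.trans (LFTJ.Query.stepBound_le_mul h𝒦 hq hBK hB fun _ => 0)
  refine (hτ.time_iterate_step_le hM N).trans ?_
  refine (mul_le_mul_of_nonneg_right hsteps (by positivity)).trans_eq ?_
  ring

theorem mainTheorem1 {σ : Type*} {ar : σ → ℕ} {k : ℕ} (Q : LFTJ.Query ar k) (κ : ℝ) :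
    ∃ C : ℝ, ∀ (K : ℕ → Set (LFTJ.Str ar)) (q M : ℕ → ℕ),
      Monotone K →
      (∀ n, LFTJ.ClosedUnderRenumbering (K n)) →
      (∀ n, IsLUB {s : ℕ | ∃ A ∈ K n, s = (Q.result A).ncard} (q n)) →
      (∀ n, IsLUB {s : ℕ | ∃ A ∈ K n, ∃ R : σ, s = (A R).card} (M n)) →
      ∀ n, ∀ A ∈ K n, ∀ τ : LFTJ.IterTime Q, τ.Meets κ A →
        ∃ c : LFTJ.Config Q, LFTJ.HaltsAt A τ c ∧
          c.out.Nodup ∧ (∀ t, t ∈ c.out ↔ t ∈ Q.result A) ∧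
          ((∃ B ∈ K n, ∀ a : Fin Q.m,
              A (Q.rel a) ⊆ B (Q.rel a) ∧ (B (Q.rel a)).Nonempty) →
            (c.time : ℝ) ≤ C * q n * max 1 (Real.logb 2 (M n))) := by
  obtain ⟨C, hC⟩ := mainTheorem1_general Q κ
  refine ⟨C, fun K q M _ hK hq hM n A hA τ hτ => ?_⟩
  obtain ⟨c, hhalt, hnodup, hmem, htime⟩ := hC A τ hτ
  exact ⟨c, hhalt, hnodup, hmem, htime (K n) (q n) (M n) (hK n)
    (fun B hB => (hq n).1 ⟨B, hB, rfl⟩) fun a => (hM n).1 ⟨A, hA, _, rfl⟩⟩
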